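/- Let $\mathbb K=\mathbb R$ or $\mathbb C$ and let $X$ be an infinite-dimensional Banach space over $\mathbb K$. Put $\Pi(X)=\{(x^*,x)\in X^*\times X:\|x^*\|=\|x\|=1,\ x^*(x)=1\}$. For a bounded linear operator $T$ on $X$ let $v(T)=\sup\{|x^*(Tx)|:(x^*,x)\in\Pi(X)\}$ be its numerical radius, and let $n(X)=\inf\{v(T):\|T\|=1\}$ be the numerical index of $X$. Assume $n(X)>0$, so that $v$ is a norm on the space of bounded linear operators on $X$, equivalent to the operator norm. Let $\mathcal L_v(X)$ be the space of bounded linear operators on $X$ with the norm $v$, and $\mathcal K_v(X)$ its subspace of compact operators. Assume that $\mathcal K_v(X)$ is an M-ideal in $\mathcal L_v(X)$; that is, $\mathcal K_v(X)$ is closed and there is a linear projection $P$ on the dual $\mathcal L_v(X)^*$ whose range is the annihilator $\mathcal K_v(X)^\perp$ and which satisfies $\|\varphi\|=\|P\varphi\|+\|\varphi-P\varphi\|$ for all $\varphi$. Then the following hold. 1. If $x,y\in X$ satisfy $\|x\|\le\|y\|$, then $$n(X)\limsup_\beta\|x+x_\beta\|\le\limsup_\beta\|y+x_\beta\|$$ for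 every bounded weakly-null net $(x_\beta)$ in $X$. 2. If $x^*,y^*\in X^*$ satisfy $\|x^*\|\le\|y^*\|$, then $$n(X)\limsup_\beta\|x^*+x^*_\beta\|\le\limsup_\beta\|y^*+x^*_\beta\|$$ for every bounded weak*-null net $(x^*_\beta)$ in $X^*$. In other words, $X$ has the properties $M(n(X),n(X))$ and $M^*(n(X),n(X))$. Here, for $r,s\in(0,1]$, property $M(r,s)$ says that $\limsup_\beta\|rx+sx_\beta\|\le\limsup_\beta\|y+x_\beta\|$ whenever $x,y\in X$, $\|x\|\le\|y\|$, and $(x_\beta)$ is a bounded weakly-null net in $X$; property $M^*(r,s)$ is the same condition for $x^*,y^*\in X^*$ with $\|x^*\|\le\|y^*\|$ and bounded weak*-null nets in $X^*$. In particular $0<n(X)\le 1$. -/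

import Mathlib

open Filter Topology

universe u v w

noncomputable section

section NumericalRadius

variable (𝕜 : Type u) [RCLike 𝕜] (X : Type v) [NormedAddCommGroup X] [NormedSpace 𝕜 X]

/-- `Π(X)`: the pairs `(x*, x)` of norm-one elements of `X* × X` with `x*(x) = 1`. -/
def numericalPairs : Set (StrongDual 𝕜 X × X) :=
  {p | ‖p.1‖ = 1 ∧ ‖p.2‖ = 1 ∧ p.1 p.2 = 1}

variable {𝕜 X}

/-- The numerical radius `v(T) = sup {|x*(T x)| : (x*, x) ∈ Π(X)}`. -/
def numericalRadius (T : X →L[𝕜] X) : ℝ :=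
  sSup ((fun p : StrongDual 𝕜 X × X => ‖p.1 (T p.2)‖) '' numericalPairs 𝕜 X)

variable (𝕜 X)

/-- The numerical index `n(X) = inf {v(T) : ‖T‖ = 1}`. -/
def numericalIndex : ℝ :=
  sInf (numericalRadius '' {T : X →L[𝕜] X | ‖T‖ = 1})

variable {𝕜 X}

theorem numericalRadius_bddAbove (T : X →L[𝕜] X) :
    BddAbove ((fun p : StrongDual 𝕜 X × X => ‖p.1 (T p.2)‖) '' numericalPairs 𝕜 X) := by
  refine ⟨‖T‖, ?_⟩
  rintro _ ⟨p, ⟨h1, h2, -⟩, rfl⟩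
  calc ‖p.1 (T p.2)‖ ≤ ‖p.1‖ * ‖T p.2‖ := p.1.le_opNorm _
    _ ≤ 1 * (‖T‖ * ‖p.2‖) := by rw [h1]; gcongr; exact T.le_opNorm _
    _ = ‖T‖ := by rw [h2]; ring

theorem le_numericalRadius (T : X →L[𝕜] X) {p : StrongDual 𝕜 X × X}
    (hp : p ∈ numericalPairs 𝕜 X) : ‖p.1 (T p.2)‖ ≤ numericalRadius T :=
  le_csSup (numericalRadius_bddAbove T) ⟨p, hp, rfl⟩

theorem numericalRadius_nonneg (T : X →L[𝕜] X) : 0 ≤ numericalRadius T :=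
  Real.sSup_nonneg (by rintro _ ⟨p, -, rfl⟩; exact norm_nonneg _)

theorem numericalRadius_le (T : X →L[𝕜] X) {C : ℝ} (hC : 0 ≤ C)
    (h : ∀ p ∈ numericalPairs 𝕜 X, ‖p.1 (T p.2)‖ ≤ C) : numericalRadius T ≤ C :=
  Real.sSup_le (by rintro _ ⟨p, hp, rfl⟩; exact h p hp) hC

theorem numericalRadius_add_le (S T : X →L[𝕜] X) :
    numericalRadius (S + T) ≤ numericalRadius S + numericalRadius T := by
  refine numericalRadius_le _ (add_nonneg (numericalRadius_nonneg S) (numericalRadius_nonneg T)) ?_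
  intro p hp
  rw [add_apply, map_add]
  exact (norm_add_le _ _).trans (add_le_add (le_numericalRadius S hp) (le_numericalRadius T hp))

theorem numericalRadius_smul_le (c : 𝕜) (T : X →L[𝕜] X) :
    numericalRadius (c • T) ≤ ‖c‖ * numericalRadius T := by
  refine numericalRadius_le _ (mul_nonneg (norm_nonneg c) (numericalRadius_nonneg T)) ?_
  intro p hp
  rw [smul_apply, map_smul, norm_smul]
  exact mul_le_mul_of_nonneg_left (le_numericalRadius T hp) (norm_nonneg c)

theorem numericalIndex_mul_norm_le (T : X →L[𝕜] X) :
    numericalIndex 𝕜 X * ‖T‖ ≤ numericalRadius T := by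
  rcases eq_or_ne T 0 with rfl | hT
  · simpa using numericalRadius_nonneg (0 : X →L[𝕜] X)
  have hpos : 0 < ‖T‖ := norm_pos_iff.mpr hT
  have hc : ‖((‖T‖ : 𝕜))⁻¹‖ = ‖T‖⁻¹ := by simp
  have h1 : ‖((‖T‖ : 𝕜))⁻¹ • T‖ = 1 := by
    rw [norm_smul, hc, inv_mul_cancel₀ hpos.ne']
  have h2 : numericalIndex 𝕜 X ≤ numericalRadius (((‖T‖ : 𝕜))⁻¹ • T) :=
    csInf_le ⟨0, by rintro _ ⟨S, -, rfl⟩; exact numericalRadius_nonneg S⟩ ⟨_, h1, rfl⟩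
  have h3 := h2.trans (numericalRadius_smul_le _ T)
  rw [hc] at h3
  calc numericalIndex 𝕜 X * ‖T‖ ≤ ‖T‖⁻¹ * numericalRadius T * ‖T‖ := by gcongr
    _ = numericalRadius T := by field_simp

/-- `L_v(X)`, for `n(X) > 0`: the space of bounded operators on `X`, as a type of its own, so that
it can carry the numerical radius as its norm in place of the operator norm. -/
def NumericalRadiusSpace (_hn : 0 < numericalIndex 𝕜 X) : Type v := X →L[𝕜] X

namespace NumericalRadiusSpace

variable (hn : 0 < numericalIndex 𝕜 X)

instance : AddCommGroup (NumericalRadiusSpace hn) :=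
  inferInstanceAs (AddCommGroup (X →L[𝕜] X))

instance : Module 𝕜 (NumericalRadiusSpace hn) :=
  inferInstanceAs (Module 𝕜 (X →L[𝕜] X))

/-- The tautological identification of `L_v(X)` with `L(X)`. -/
def toCLM : NumericalRadiusSpace hn ≃ₗ[𝕜] (X →L[𝕜] X) :=
  LinearEquiv.refl 𝕜 (X →L[𝕜] X)

/-- The numerical radius, which is a norm on `L(X)` because `n(X) > 0`. -/
def radiusNorm : AddGroupNorm (NumericalRadiusSpace hn) where
  toFun T := numericalRadius (toCLM hn T)
  map_zero' := le_antisymm (numericalRadius_le _ le_rfl (by simp)) (numericalRadius_nonneg _)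
  add_le' S T := by
    rw [map_add]
    exact numericalRadius_add_le _ _
  neg' T := by simp [numericalRadius]
  eq_zero_of_map_eq_zero' T hT := by
    have h := numericalIndex_mul_norm_le (toCLM hn T)
    rw [hT] at h
    have h0 : ‖toCLM hn T‖ ≤ 0 := by
      by_contra! hlt
      exact absurd h (not_le.mpr (mul_pos hn hlt))
    exact (toCLM hn).map_eq_zero_iff.mp (norm_le_zero_iff.mp h0)

instance : NormedAddCommGroup (NumericalRadiusSpace hn) :=
  (radiusNorm hn).toNormedAddCommGroup

theorem norm_def (T : NumericalRadiusSpace hn) : ‖T‖ = numericalRadius (toCLM hn T) := rfl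

instance : NormedSpace 𝕜 (NumericalRadiusSpace hn) where
  norm_smul_le c T := by
    rw [norm_def, norm_def, map_smul]
    exact numericalRadius_smul_le c _

/-- `K_v(X)`: the subspace of compact operators in `L_v(X)`. -/
def compacts : Submodule 𝕜 (NumericalRadiusSpace hn) :=
  (compactOperator (RingHom.id 𝕜) X X).comap (toCLM hn).toLinearMap

end NumericalRadiusSpace

end NumericalRadius

section MIdeal

variable {𝕜 : Type u} [RCLike 𝕜] {E : Type v} [NormedAddCommGroup E] [NormedSpace 𝕜 E]

/-- The annihilator `J^⊥` of a subspace `J` of `E`, in the dual `E*`. -/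
def dualAnnihilator (J : Submodule 𝕜 E) : Submodule 𝕜 (StrongDual 𝕜 E) where
  carrier := {φ | ∀ x ∈ J, φ x = 0}
  add_mem' hφ hψ x hx := by simp [hφ x hx, hψ x hx]
  zero_mem' x _ := by simp
  smul_mem' c φ hφ x hx := by simp [hφ x hx]

/-- A closed subspace `J` is an M-ideal in `E` if its annihilator is an L-summand of the dual:
it is the range of a linear projection `P` on `E*` with `‖φ‖ = ‖P φ‖ + ‖φ - P φ‖` for all `φ`.
(The kernel of `P` is then isometric to `J*` by restriction, so that `E* = J* ⊕₁ J^⊥`.) -/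
def IsMIdeal (J : Submodule 𝕜 E) : Prop :=
  IsClosed (J : Set E) ∧
    ∃ P : StrongDual 𝕜 E →L[𝕜] StrongDual 𝕜 E,
      IsLprojection (StrongDual 𝕜 E) P ∧ P.range = dualAnnihilator J

end MIdeal

section PropertyM

variable (𝕜 : Type u) [RCLike 𝕜] (X : Type v) [NormedAddCommGroup X] [NormedSpace 𝕜 X]

/-- `(x_β)` is a bounded weakly-null net in `X`. -/
def IsBoundedWeaklyNull {X : Type v} [NormedAddCommGroup X] [NormedSpace 𝕜 X]
    {ι : Type w} [Preorder ι] (x : ι → X) : Prop :=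
  (∃ C : ℝ, ∀ β, ‖x β‖ ≤ C) ∧ Tendsto (fun β => toWeakSpace 𝕜 X (x β)) atTop (𝓝 0)

/-- `(x*_β)` is a bounded weak*-null net in `X*`. -/
def IsBoundedWeakStarNull {𝕜 : Type u} [RCLike 𝕜] {X : Type v}
    [NormedAddCommGroup X] [NormedSpace 𝕜 X] {ι : Type w} [Preorder ι] (x : ι → StrongDual 𝕜 X) : Prop :=
  (∃ C : ℝ, ∀ β, ‖x β‖ ≤ C) ∧ Tendsto (fun β => StrongDual.toWeakDual (x β)) atTop (𝓝 0)

/-- Property `M(r, s)`, for `r, s ∈ (0, 1]`: the inequality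
`limsup ‖r x + s x_β‖ ≤ limsup ‖y + x_β‖` whenever `‖x‖ ≤ ‖y‖` and `(x_β)` is a bounded
weakly-null net in `X`. The nets are indexed by directed sets in the universe `w`. -/
def HasPropertyM (r s : ℝ) : Prop :=
  r ∈ Set.Ioc 0 1 ∧ s ∈ Set.Ioc 0 1 ∧
    ∀ x y : X, ‖x‖ ≤ ‖y‖ →
      ∀ (ι : Type w) [Preorder ι] [IsDirectedOrder ι] [Nonempty ι] (z : ι → X),
        IsBoundedWeaklyNull 𝕜 z →
          limsup (fun β => ‖(r : 𝕜) • x + (s : 𝕜) • z β‖) atTop ≤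
            limsup (fun β => ‖y + z β‖) atTop

/-- Property `M*(r, s)`, for `r, s ∈ (0, 1]`: the analogue of `M(r, s)` in the dual `X*`, for
bounded weak*-null nets. -/
def HasPropertyMStar (r s : ℝ) : Prop :=
  r ∈ Set.Ioc 0 1 ∧ s ∈ Set.Ioc 0 1 ∧
    ∀ x y : StrongDual 𝕜 X, ‖x‖ ≤ ‖y‖ →
      ∀ (ι : Type w) [Preorder ι] [IsDirectedOrder ι] [Nonempty ι] (z : ι → StrongDual 𝕜 X),
        IsBoundedWeakStarNull z →
          limsup (fun β => ‖(r : 𝕜) • x + (s : 𝕜) • z β‖) atTop ≤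
            limsup (fun β => ‖y + z β‖) atTop

end PropertyM

end

/-!
The M-ideal hypothesis is turned into the existence of compact operators `K` such that, for a given
compact `S` with `‖S‖ ≤ 1` and a given vector `y`, the numerical radius of `S + 1 - K` is at most
`1 + ε` and `K y` is close to `y` (`exists_compact_norm_sub_apply_lt`; for functionals,
`exists_compact_norm_sub_comp_lt`). Properties `M` and `M*` follow as in the classical case of the
operator norm: if `‖x‖ ≤ ‖y‖`, take `S` of rank one with `S y = x`. On a bounded weakly-null net `z`
both `S` and `K` are norm-null, so `(S + 1 - K) (y + z β)` is approximately `x + z β`, whereas the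
norm of `S + 1 - K` is at most `(1 + ε) / n(X)`.

By the Hahn–Banach theorem and the L-decomposition of `L_v(X)*`, an operator `K` of this kind exists
as soon as `P`, the L-projection onto the annihilator of the compact operators, satisfies
`(P ω) (1) = 0` for every functional `ω : T ↦ z (T* q)` with `q ∈ X*` and `z ∈ X**`. For pairs
`(q, z) = (x*, x) ∈ Π(X)` this is immediate, as `ω` then attains its norm at the compact operator
`x* ⊗ x` (`elementaryFunctional_inclusion_proj_eq_zero`). In general it says that the operator
`A : X* → X***`, `A q z = ((1 - P) ω) (1)`, is the canonical embedding `j`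
(`limitOperator_eq_inclusion`). The proof of this has three steps. Let `π : X*** → X*` be the
restriction to `X`.

* Numerical ranges. An operator `T` with `v(T) ≤ 1 + ε` satisfies
  `‖1 + t (T - 1)‖ ≤ 1 + t ε + O(t²)`. Applied to `T = K` and to `T = S + 1 - K`, for `S` of rank
  one and `K` compact and close to the identity, it gives `‖q + t (π A q - q)‖ ≤ (1 + O(t²)) ‖q‖`
  and `‖ρ - t A π ρ‖ + t ‖π ρ‖ ≤ (1 + O(t²)) ‖ρ‖` (`flowBounds_limitOperator`). The second estimate uses
  that `K**` maps `X**` into `X`.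

* A flow. By the second bound, `‖ρ‖` decreases at rate at least `‖π ρ‖` along `ρ' = -A π ρ`; by both
  bounds, `π A - 1` is skew, so that `‖π ρ‖` decreases at rate at most `‖π ρ‖`. Follow the quantity
  `‖π ρ‖ + ‖ξ‖ - ‖ρ‖` from `ρ = R p + ξ`, where `π ξ = 0`, to its limit: it increases to something
  nonpositive, so that `‖π R p‖ + ‖ξ‖ ≤ ‖R p + ξ‖` (`FlowBounds.norm_add_norm_le`), both for `R = A`
  and for `R = j`. The first case shows that `A = j π A`, the second that `X***` is the `ℓ¹`-sum of
  `X*` and the annihilator `X^⊥`.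

* Rigidity. The second adjoint of the skew operator `V = π A - 1` respects the `ℓ¹`-sum, so `V` is
  the adjoint of an operator `W` on `X` (`FlowBounds.exists_preadjoint`). The values of `A` on the
  pairs in `Π(X)` being known, `v(W) = 0`. As `n(X) > 0`, this forces `W = 0`, and so `A = j`.
-/

noncomputable section

/-! ### Separation and simultaneous approximation -/

section WeakSeparation

open RCLike

variable {𝕜 : Type*} [RCLike 𝕜] {G H : Type*} [AddCommGroup G] [Module 𝕜 G] [Module ℝ G]
  [IsScalarTower ℝ 𝕜 G] [AddCommGroup H] [Module 𝕜 H]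

/-- Strict separation of a point from a compact convex set in the weak topology of a pairing. The
set is a subset of `WeakBilin B`, but the functional is produced as an element `q` of `H`. -/
theorem WeakBilin.exists_re_lt_re_of_notMem (B : G →ₗ[𝕜] H →ₗ[𝕜] 𝕜)
    (hB : Function.Injective B) {s : Set (WeakBilin B)} (hs : Convex ℝ s)
    (hs' : IsCompact s) {z : WeakBilin B} (hz : z ∉ s) :
    ∃ (q : H) (b : ℝ), (∀ f ∈ s, re (B f q) < b) ∧ b < re (B z q) := by
  have _ : IsScalarTower ℝ 𝕜 (WeakBilin B) := inferInstanceAs (IsScalarTower ℝ 𝕜 G)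
  have _ : T2Space (WeakBilin B) := (WeakBilin.isEmbedding hB).t2Space
  obtain ⟨f, b, h1, h2⟩ := RCLike.geometric_hahn_banach_closed_point (𝕜 := 𝕜) hs hs'.isClosed hz
  obtain ⟨q, rfl⟩ := LinearMap.dualEmbedding_surjective B f
  exact ⟨q, b, h1, h2⟩

end WeakSeparation

section Separation

open RCLike

variable {𝕜 : Type*} [RCLike 𝕜] {E : Type*} [NormedAddCommGroup E] [NormedSpace 𝕜 E]
  {F : Type*} [NormedAddCommGroup F] [NormedSpace 𝕜 F]

theorem eq_zero_of_forall_re_mul_le {a : 𝕜} {b : ℝ} (h : ∀ c : 𝕜, re (c * a) ≤ b) : a = 0 := by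
  by_contra hne
  have := h (((b + 1 : ℝ) : 𝕜) * a⁻¹)
  rw [mul_assoc, inv_mul_cancel₀ hne, mul_one, ofReal_re] at this
  linarith

theorem exists_norm_one_re_map_smul (φ : StrongDual 𝕜 E) (x : E) :
    ∃ c : 𝕜, ‖c‖ = 1 ∧ re (φ (c • x)) = ‖φ x‖ := by
  obtain ⟨c, hc, h⟩ := RCLike.exists_norm_eq_mul_self (φ x)
  exact ⟨c, hc, by rw [map_smul, smul_eq_mul, ← h, ofReal_re]⟩

/-- A functional whose real part is at most `b` on the open ball of radius `r` has norm at most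
`b / r`. -/
theorem mul_norm_le_of_forall_re_le (φ : StrongDual 𝕜 E) {r b : ℝ} (hr : 0 < r) (hb : 0 ≤ b)
    (h : ∀ x : E, ‖x‖ < r → re (φ x) ≤ b) : r * ‖φ‖ ≤ b := by
  rw [mul_comm, ← le_div_iff₀ hr]
  refine ContinuousLinearMap.opNorm_le_of_unit_norm (div_nonneg hb hr.le) fun x hx => ?_
  rw [le_div_iff₀ hr]
  refine le_of_forall_lt_imp_le_of_dense fun y hy => ?_
  rcases le_or_gt y 0 with h0 | h0
  · exact h0.trans hb
  have hφ : 0 < ‖φ x‖ := by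
    by_contra! hle
    nlinarith [norm_nonneg (φ x)]
  obtain ⟨c, hc, hre⟩ := exists_norm_one_re_map_smul φ x
  have hs : 0 < y / ‖φ x‖ := div_pos h0 hφ
  have hy' : y / ‖φ x‖ < r := by rwa [div_lt_iff₀ hφ, mul_comm]
  have := h (((y / ‖φ x‖ : ℝ) : 𝕜) • c • x) (by
    rw [norm_smul, norm_smul, hc, hx, norm_ofReal, abs_of_pos hs]; simpa using hy')
  rwa [map_smul, smul_eq_mul, re_ofReal_mul, hre, div_mul_cancel₀ _ hφ.ne'] at this

theorem Submodule.exists_dual_eq_zero_ne_zero_of_isClosed {p : Submodule 𝕜 E}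
    (hp : IsClosed (p : Set E)) {x : E} (hx : x ∉ p) :
    ∃ f : StrongDual 𝕜 E, (∀ y ∈ p, f y = 0) ∧ f x ≠ 0 := by
  let _ : NormedSpace ℝ E := NormedSpace.restrictScalars ℝ 𝕜 E
  have _ : IsScalarTower ℝ 𝕜 E := inferInstance
  obtain ⟨f, b, h1, h2⟩ := RCLike.geometric_hahn_banach_closed_point (𝕜 := 𝕜)
    (p.restrictScalars ℝ).convex hp hx
  have h0 : ∀ y ∈ p, f y = 0 := fun y hy => eq_zero_of_forall_re_mul_le fun c => by
    rw [← smul_eq_mul, ← map_smul]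
    exact (h1 _ (p.smul_mem c hy)).le
  refine ⟨f, h0, fun hfx => ?_⟩
  have h3 := h1 0 p.zero_mem
  rw [map_zero, map_zero] at h3
  rw [hfx, map_zero] at h2
  linarith

/-- Simultaneous approximation by elements of a subspace `J`: one `k ∈ J` can be chosen with
`a - k` almost in the unit ball of `E` and `L k` close to `w`, as soon as the corresponding
inequality holds for all functionals that could separate the two requirements. This is the
Hahn–Banach theorem in `E × F`, and replaces the passage to a weak-star convergent net in `J` that
is improved by convex combinations. -/
theorem exists_mem_norm_sub_lt_of_dual_bound (J : Submodule 𝕜 E) (L : E →L[𝕜] F) (a : E) (w : F)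
    (h : ∀ (φ : StrongDual 𝕜 E) (g : StrongDual 𝕜 F), φ + g ∘L L ∈ dualAnnihilator J →
      re (φ a + g w) ≤ ‖φ‖) {ε : ℝ} (hε : 0 < ε) :
    ∃ k ∈ J, ‖a - k‖ < 1 + ε ∧ ‖w - L k‖ < ε := by
  by_contra! hcon
  let _ : NormedSpace ℝ E := NormedSpace.restrictScalars ℝ 𝕜 E
  let _ : NormedSpace ℝ F := NormedSpace.restrictScalars ℝ 𝕜 F
  have _ : IsScalarTower ℝ 𝕜 E := inferInstance
  have _ : IsScalarTower ℝ 𝕜 F := inferInstance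
  set s : Set (E × F) := Metric.ball 0 (1 + ε) ×ˢ Metric.ball 0 ε with hs
  set t : Set (E × F) := (fun k : E => (a - k, w - L k)) '' (J : Set E) with ht
  have hs1 : Convex ℝ s := (convex_ball _ _).prod (convex_ball _ _)
  have hs2 : IsOpen s := Metric.isOpen_ball.prod Metric.isOpen_ball
  have ht1 : Convex ℝ t := by
    rintro _ ⟨k, hk, rfl⟩ _ ⟨l, hl, rfl⟩ α β hα hβ hαβ
    refine ⟨(α : 𝕜) • k + (β : 𝕜) • l, J.add_mem (J.smul_mem _ hk) (J.smul_mem _ hl), ?_⟩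
    obtain rfl : β = 1 - α := by linarith
    ext
    · simp only [Prod.smul_mk, Prod.mk_add_mk, RCLike.real_smul_eq_coe_smul (K := 𝕜)]
      push_cast
      module
    · simp only [Prod.smul_mk, Prod.mk_add_mk, RCLike.real_smul_eq_coe_smul (K := 𝕜), map_add,
        map_smul]
      push_cast
      module
  have hdisj : Disjoint s t := by
    rw [Set.disjoint_right]
    rintro _ ⟨k, hk, rfl⟩ ⟨h1, h2⟩
    simp only [mem_ball_zero_iff] at h1 h2
    exact absurd h2 (not_lt.mpr (hcon k hk h1))
  obtain ⟨Φ, b, hb1, hb2⟩ :=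
    RCLike.geometric_hahn_banach_open (𝕜 := 𝕜) hs1 hs2 ht1 hdisj
  set φ : StrongDual 𝕜 E := Φ ∘L ContinuousLinearMap.inl 𝕜 E F with hφ
  set g : StrongDual 𝕜 F := Φ ∘L ContinuousLinearMap.inr 𝕜 E F with hg
  have hΦ : ∀ x y, Φ (x, y) = φ x + g y := fun x y => by
    simp [hφ, hg, ← map_add]
  have hb0 : 0 < b := by
    have := hb1 (0, 0) ⟨by simp; linarith, by simpa using hε⟩
    simpa [hΦ] using this
  have hbφ : (1 + ε) * ‖φ‖ ≤ b := by
    refine mul_norm_le_of_forall_re_le φ (by linarith) hb0.le fun x hx => ?_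
    have := hb1 (x, 0) ⟨by simpa using hx, by simpa using hε⟩
    simpa [hΦ] using this.le
  have hann : φ + g ∘L L ∈ dualAnnihilator J := by
    intro k hk
    refine eq_zero_of_forall_re_mul_le (b := re (φ a + g w) - b) fun c => ?_
    have := hb2 _ ⟨c • k, J.smul_mem c hk, rfl⟩
    rw [hΦ] at this
    simp only [map_sub, map_smul, map_add, smul_eq_mul, add_apply,
      ContinuousLinearMap.comp_apply, mul_add] at this ⊢
    linarith
  have h1 := h φ g hann
  have h2 := hb2 _ ⟨0, J.zero_mem, rfl⟩
  rw [hΦ] at h2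
  simp only [sub_zero, map_zero] at h2
  nlinarith [norm_nonneg φ]

/-- The second adjoint of a compact operator `K : E → F` maps `E**` into `F`: there is `y : F` with
`K** z = y`. The closure of the image under `K` of a ball of radius larger than `‖z‖` is compact and
convex, hence closed for the pointwise topology on the algebraic dual of `F*`, so that a functional
would separate `K** z` from it if it were not a member. -/
theorem IsCompactOperator.exists_map_comp_eq {K : E →L[𝕜] F}
    (hK : IsCompactOperator K) (z : StrongDual 𝕜 (StrongDual 𝕜 E)) :
    ∃ y : F, ∀ q : StrongDual 𝕜 F, z (q ∘L K) = q y := by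
  let _ : NormedSpace ℝ E := NormedSpace.restrictScalars ℝ 𝕜 E
  let _ : NormedSpace ℝ F := NormedSpace.restrictScalars ℝ 𝕜 F
  have _ : IsScalarTower ℝ 𝕜 F := inferInstance
  let B : (StrongDual 𝕜 F →ₗ[𝕜] 𝕜) →ₗ[𝕜] StrongDual 𝕜 F →ₗ[𝕜] 𝕜 := LinearMap.id
  let j : F →ₗ[𝕜] (StrongDual 𝕜 F →ₗ[𝕜] 𝕜) := (topDualPairing 𝕜 F).flip
  set r := ‖z‖ + 1 with hr
  have hr0 : 0 < r := by positivity
  set s : Set F := closure (K '' Metric.ball 0 r) with hs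
  have hsc : IsCompact s := hK.isCompact_closure_image_ball r
  have hsconv : Convex ℝ s := by
    refine Convex.closure ?_
    exact (convex_ball (0 : E) r).linear_image (K.restrictScalars ℝ : E →ₗ[ℝ] F)
  have hj : Continuous (Y := WeakBilin B) (fun y : F => j y) :=
    WeakBilin.continuous_of_continuous_eval B fun q => (q.continuous : Continuous fun y => q y)
  have htconv : Convex ℝ (j '' s) := by
    rintro _ ⟨a, ha, rfl⟩ _ ⟨b, hb, rfl⟩ α β hα hβ hαβ
    refine ⟨α • a + β • b, hsconv ha hb hα hβ hαβ, ?_⟩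
    have hsm : ∀ (c : ℝ) (y : F), j (c • y) = c • j y := fun c y => by
      rw [← smul_one_smul 𝕜 c y, map_smul, smul_one_smul]
    rw [map_add, hsm, hsm]
  let z' : StrongDual 𝕜 F →ₗ[𝕜] 𝕜 := z ∘L ContinuousLinearMap.precomp 𝕜 K
  by_cases hz : z' ∈ j '' s
  · obtain ⟨y, -, hy⟩ := hz
    exact ⟨y, fun q => (DFunLike.congr_fun hy q).symm⟩
  exfalso
  obtain ⟨q, u, hf1, hf2⟩ := WeakBilin.exists_re_lt_re_of_notMem B Function.injective_id
    htconv (hsc.image hj) hz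
  have h1 : ∀ x : E, ‖x‖ < r → re ((q ∘L K) x) ≤ u := fun x hx =>
    (hf1 _ ⟨K x, subset_closure ⟨x, by simpa using hx, rfl⟩, rfl⟩).le
  have hu : 0 ≤ u := by simpa using h1 0 (by simpa using hr0)
  have h2 := mul_norm_le_of_forall_re_le (q ∘L K) hr0 hu h1
  have h3 : u < re (z (q ∘L K)) := hf2
  have h4 := (re_le_norm _).trans (z.le_opNorm (q ∘L K))
  nlinarith [norm_nonneg (q ∘L K)]

end Separation

/-! ### A flow argument for skew operators -/

section Flow

variable {𝕜 : Type*} [RCLike 𝕜] {Y : Type*} [NormedAddCommGroup Y] [NormedSpace 𝕜 Y]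
  {Z : Type*} [NormedAddCommGroup Z] [NormedSpace 𝕜 Z]

/-- A contractive retraction `π` of `Z` onto `Y`, with contractive section `j`, together with an
operator `A : Y → Z` that satisfies two estimates to first order in the step length `t`, with the
error bounded by `c t²`. In the application `Y = X*`, `Z = X***`, the map `π` is restriction to `X`
and `j` is the canonical embedding. -/
structure FlowBounds (π : Z →L[𝕜] Y) (j : Y →L[𝕜] Z) (A : Y →L[𝕜] Z) (c : ℝ) : Prop where
  nonneg : 0 ≤ c
  norm_proj_le : ∀ ρ, ‖π ρ‖ ≤ ‖ρ‖
  proj_incl : ∀ q, π (j q) = q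
  norm_incl_le : ∀ q, ‖j q‖ ≤ ‖q‖
  /-- Along the flow `ρ' = -A π ρ`, the norm of `ρ` decreases at rate at least `‖π ρ‖`. -/
  step : ∀ ρ (t : ℝ), 0 ≤ t → ‖ρ - (t : 𝕜) • A (π ρ)‖ + t * ‖π ρ‖ ≤ (1 + c * t ^ 2) * ‖ρ‖
  /-- The flow `q' = (π A - 1) q` does not increase norms. By `step` the reverse flow does not
  either, so that `π A - 1` generates isometries: it is skew. -/
  skew : ∀ q (t : ℝ), 0 ≤ t → ‖q + (t : 𝕜) • (π (A q) - q)‖ ≤ (1 + c * t ^ 2) * ‖q‖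

namespace FlowBounds

variable {π : Z →L[𝕜] Y} {j : Y →L[𝕜] Z} {A : Y →L[𝕜] Z} {c : ℝ}

/-- `π A` expands by at least the factor one: the flow `q' = -π A q` contracts at unit rate. -/
theorem norm_sub_smul_le (h : FlowBounds π j A c) (q : Y) {t : ℝ} (ht : 0 ≤ t) :
    ‖q - (t : 𝕜) • π (A q)‖ ≤ (1 - t + c * t ^ 2) * ‖q‖ := by
  have h1 := h.step (j q) t ht
  rw [h.proj_incl] at h1
  have h2 := h.norm_proj_le (j q - (t : 𝕜) • A q)
  rw [map_sub, map_smul, h.proj_incl] at h2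
  have h3 := mul_le_mul_of_nonneg_left (h.norm_incl_le q)
    (by have := h.nonneg; positivity : 0 ≤ 1 + c * t ^ 2)
  linarith

/-- The reverse of the bound `FlowBounds.skew`. -/
theorem norm_sub_smul_skew_le (h : FlowBounds π j A c) (q : Y) {t : ℝ} (ht : 0 ≤ t) :
    ‖q - (t : 𝕜) • (π (A q) - q)‖ ≤ (1 + c * t ^ 2) * ‖q‖ := by
  have h1 := h.norm_sub_smul_le q ht
  have h2 : q - (t : 𝕜) • (π (A q) - q) = (q - (t : 𝕜) • π (A q)) + (t : 𝕜) • q := by module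
  rw [h2]
  refine (norm_add_le _ _).trans ?_
  rw [norm_smul, RCLike.norm_ofReal, abs_of_nonneg ht]
  linarith

/-- The flow `q' = -π A q` contracts at no more than unit rate, because the flow of
`π A - 1` does not increase norms. -/
theorem exists_le_norm_sub_smul (h : FlowBounds π j A c) :
    ∃ C, 0 ≤ C ∧ ∀ (q : Y) (t : ℝ), 0 ≤ t → t ≤ 1 / 2 →
      (1 - t - C * t ^ 2) * ‖q‖ ≤ ‖q - (t : 𝕜) • π (A q)‖ := by
  set V : Y →L[𝕜] Y := π ∘L A - ContinuousLinearMap.id 𝕜 Y with hV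
  have hVq : ∀ q, π (A q) - q = V q := fun q => by simp [hV]
  have hc := h.nonneg
  refine ⟨2 * ‖V‖ ^ 2 + 4 * c, by positivity, fun q t ht ht' => ?_⟩
  set y := q - (t : 𝕜) • π (A q) with hy
  have hy' : y = ((1 - t : ℝ) : 𝕜) • q - (t : 𝕜) • V q := by
    rw [hy, ← hVq]; push_cast; module
  set s := t / (1 - t) with hs
  have h1t : 0 < 1 - t := by linarith
  have hs0 : 0 ≤ s := div_nonneg ht h1t.le
  have hs2 : s ≤ 2 * t := by rw [hs, div_le_iff₀ h1t]; nlinarith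
  have hst : s * (1 - t) = t := by rw [hs]; field_simp
  have h1 := h.skew y s hs0
  rw [hVq] at h1
  -- multiplying `(1 - t) - t V` by `1 + s V` with `s (1 - t) = t` cancels the first-order term
  have h2 : y + (s : 𝕜) • V y =
      ((1 - t : ℝ) : 𝕜) • q - ((s * t : ℝ) : 𝕜) • V (V q) := by
    rw [hy', map_sub, map_smul, map_smul, smul_sub, smul_smul, smul_smul, ← RCLike.ofReal_mul,
      ← RCLike.ofReal_mul, hst]
    abel
  have h3 : (1 - t) * ‖q‖ - s * t * (‖V‖ ^ 2 * ‖q‖) ≤ ‖y + (s : 𝕜) • V y‖ := by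
    rw [h2]
    refine le_trans ?_ (norm_sub_norm_le _ _)
    rw [norm_smul, norm_smul, RCLike.norm_ofReal, RCLike.norm_ofReal, abs_of_pos h1t,
      abs_of_nonneg (by positivity)]
    have : ‖V (V q)‖ ≤ ‖V‖ ^ 2 * ‖q‖ := by
      calc ‖V (V q)‖ ≤ ‖V‖ * (‖V‖ * ‖q‖) := V.le_opNorm_of_le (V.le_opNorm q)
        _ = _ := by ring
    gcongr
  have h4 : s * t * (‖V‖ ^ 2 * ‖q‖) ≤ 2 * t * t * (‖V‖ ^ 2 * ‖q‖) := by gcongr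
  have h5 : (1 + c * s ^ 2) * ‖y‖ ≤ (1 + c * (2 * t) ^ 2) * ‖y‖ := by gcongr
  set a := t + 2 * ‖V‖ ^ 2 * t ^ 2
  set b := 4 * c * t ^ 2
  have ha : 0 ≤ a := by positivity
  have hb : 0 ≤ b := by positivity
  have h6 : (1 - a) * ‖q‖ ≤ (1 + b) * ‖y‖ := by
    simp only [a, b]; nlinarith
  have h7 : (1 + b) * ((1 - a - b) * ‖q‖) ≤ (1 + b) * ‖y‖ := by
    refine le_trans ?_ h6
    have : 0 ≤ (a * b + b ^ 2) * ‖q‖ := by positivity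
    nlinarith
  have h8 := le_of_mul_le_mul_left h7 (by linarith)
  have h9 : 1 - t - (2 * ‖V‖ ^ 2 + 4 * c) * t ^ 2 = 1 - a - b := by simp only [a, b]; ring
  rwa [h9]

/-- The discrete flow argument. Let `R` intertwine `A π` and `π A`, and let `π ξ = 0`. Under the
Euler step `r ↦ r - t π (A r)` the point `ρ = R r + ξ` moves to `ρ - t A (π ρ)`, so `‖ρ‖` drops by
at least `t ‖π ρ‖`, while `‖π ρ‖` drops by at most that much, both up to `O(t²)`. Hence the defect
`‖π ρ‖ + ‖ξ‖ - ‖ρ‖` is almost nondecreasing, and after `k` steps `r` is so small that the defect is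
almost nonpositive. -/
theorem exists_pow_bound (h : FlowBounds π j A c) (R : Y →L[𝕜] Z)
    (hR : ∀ p, A (π (R p)) = R (π (A p))) (p : Y) (ξ : Z) (hξ : π ξ = 0) :
    ∃ D t₀ : ℝ, 0 < t₀ ∧ ∀ t : ℝ, 0 < t → t ≤ t₀ → ∀ k : ℕ,
      ‖π (R p)‖ + ‖ξ‖ - ‖R p + ξ‖ ≤ 2 * ‖R‖ * ‖p‖ * (1 - t / 2) ^ k + k * (D * t ^ 2) := by
  obtain ⟨C, hC, hlow⟩ := h.exists_le_norm_sub_smul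
  have hc := h.nonneg
  set M := ‖R‖ * ‖p‖ + ‖ξ‖ with hM
  refine ⟨(C + c) * M, min (1 / 2) (1 / (2 * (c + 1))), by positivity, fun t ht htt k => ?_⟩
  have ht2 : t ≤ 1 / 2 := htt.trans (min_le_left _ _)
  have htc : c * t ≤ 1 / 2 := by
    have h1 := htt.trans (min_le_right _ _)
    rw [le_div_iff₀ (by positivity)] at h1
    nlinarith
  have hstep : ∀ r : Y, ‖r - (t : 𝕜) • π (A r)‖ ≤ (1 - t / 2) * ‖r‖ := fun r => by
    refine (h.norm_sub_smul_le r ht.le).trans ?_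
    gcongr
    nlinarith
  -- the defect at `R r + ξ` changes by at most `O(t²)` in one step `r ↦ r - t π A r`
  have hdef : ∀ r : Y, ‖r‖ ≤ ‖p‖ →
      ‖π (R r)‖ + ‖ξ‖ - ‖R r + ξ‖ ≤
        ‖π (R (r - (t : 𝕜) • π (A r)))‖ + ‖ξ‖ - ‖R (r - (t : 𝕜) • π (A r)) + ξ‖
          + (C + c) * M * t ^ 2 := by
    intro r hr
    have hρM : ‖R r + ξ‖ ≤ M := (norm_add_le _ _).trans
      (by rw [hM]; gcongr; exact R.le_opNorm_of_le hr)
    have hπρ : π (R r + ξ) = π (R r) := by rw [map_add, hξ, add_zero]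
    have hqM : ‖π (R r)‖ ≤ M := by
      rw [← hπρ]; exact (h.norm_proj_le _).trans hρM
    have e1 : R (r - (t : 𝕜) • π (A r)) + ξ = (R r + ξ) - (t : 𝕜) • A (π (R r + ξ)) := by
      rw [hπρ, hR, map_sub, map_smul]; abel
    have e2 : π (R (r - (t : 𝕜) • π (A r))) = π (R r) - (t : 𝕜) • π (A (π (R r))) := by
      rw [hR, map_sub, map_sub, map_smul, map_smul]
    have s1 := h.step (R r + ξ) t ht.le
    rw [← e1, hπρ] at s1
    have s2 := hlow (π (R r)) t ht.le ht2
    rw [← e2] at s2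
    have s3 : c * t ^ 2 * ‖R r + ξ‖ ≤ c * t ^ 2 * M := by gcongr
    have s4 : C * t ^ 2 * ‖π (R r)‖ ≤ C * t ^ 2 * M := by gcongr
    nlinarith
  have hiter : ∀ k : ℕ, ∃ r : Y, ‖r‖ ≤ (1 - t / 2) ^ k * ‖p‖ ∧
      ‖π (R p)‖ + ‖ξ‖ - ‖R p + ξ‖ ≤
        ‖π (R r)‖ + ‖ξ‖ - ‖R r + ξ‖ + k * ((C + c) * M * t ^ 2) := by
    intro k
    induction k with
    | zero => exact ⟨p, by simp, by simp⟩
    | succ k ih =>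
      obtain ⟨r, hr1, hr2⟩ := ih
      refine ⟨r - (t : 𝕜) • π (A r), (hstep r).trans ?_, ?_⟩
      · rw [pow_succ']
        calc (1 - t / 2) * ‖r‖ ≤ (1 - t / 2) * ((1 - t / 2) ^ k * ‖p‖) := by
              gcongr; linarith
          _ = _ := by ring
      · have hrp : ‖r‖ ≤ ‖p‖ := hr1.trans (mul_le_of_le_one_left (norm_nonneg _)
          (pow_le_one₀ (by linarith) (by linarith)))
        have := hdef r hrp
        push_cast
        linarith
  obtain ⟨r, hr1, hr2⟩ := hiter k
  have h1 : ‖π (R r)‖ ≤ ‖R‖ * ‖r‖ := (h.norm_proj_le _).trans (R.le_opNorm r)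
  have h2 : ‖ξ‖ ≤ ‖R r + ξ‖ + ‖R‖ * ‖r‖ := by
    have := norm_sub_le (R r + ξ) (R r)
    rw [add_sub_cancel_left] at this
    linarith [R.le_opNorm r]
  have h3 : ‖R‖ * ‖r‖ ≤ ‖R‖ * ((1 - t / 2) ^ k * ‖p‖) := by gcongr
  linarith

theorem norm_add_norm_le (h : FlowBounds π j A c) (R : Y →L[𝕜] Z)
    (hR : ∀ p, A (π (R p)) = R (π (A p))) (p : Y) (ξ : Z) (hξ : π ξ = 0) :
    ‖π (R p)‖ + ‖ξ‖ ≤ ‖R p + ξ‖ := by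
  obtain ⟨D, t₀, ht₀, hb⟩ := h.exists_pow_bound R hR p ξ hξ
  have hlim : Tendsto (fun n : ℕ => 2 * ‖R‖ * ‖p‖ * Real.exp (-((n : ℝ) / 2)) + D * (1 / (n : ℝ)))
      atTop (𝓝 (2 * ‖R‖ * ‖p‖ * 0 + D * 0)) := by
    refine Tendsto.add (Tendsto.const_mul _ ?_) (Tendsto.const_mul _ ?_)
    · exact Real.tendsto_exp_neg_atTop_nhds_zero.comp
        (tendsto_natCast_atTop_atTop.atTop_div_const (by norm_num))
    · exact tendsto_one_div_atTop_nhds_zero_nat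
  have hsmall : ∀ᶠ n : ℕ in atTop, 1 / (n : ℝ) < min t₀ 1 :=
    tendsto_one_div_atTop_nhds_zero_nat.eventually (gt_mem_nhds (by positivity))
  have key : ‖π (R p)‖ + ‖ξ‖ - ‖R p + ξ‖ ≤ 2 * ‖R‖ * ‖p‖ * 0 + D * 0 := by
    refine ge_of_tendsto hlim ?_
    filter_upwards [hsmall, eventually_gt_atTop 0] with n hn hn0
    have hn' : (0 : ℝ) < n := by exact_mod_cast hn0
    have h1 : (1 : ℝ) / n ≤ 1 := (hn.trans_le (min_le_right _ _)).le
    have ht : (1 / (n : ℝ)) ^ 2 ≤ t₀ := by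
      have h2 : (1 : ℝ) / n ≤ t₀ := (hn.trans_le (min_le_left _ _)).le
      have h3 : (0 : ℝ) ≤ 1 / n := by positivity
      nlinarith
    -- step length `n⁻²` and `n³` steps: total time `n`, total error `O(1 / n)`
    refine (hb ((1 / (n : ℝ)) ^ 2) (by positivity) ht (n ^ 3)).trans ?_
    have e1 : ((n ^ 3 : ℕ) : ℝ) * (D * ((1 / (n : ℝ)) ^ 2) ^ 2) = D * (1 / (n : ℝ)) := by
      push_cast; field_simp
    have e2 : (1 - (1 / (n : ℝ)) ^ 2 / 2) ^ (n ^ 3) ≤ Real.exp (-((n : ℝ) / 2)) := by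
      have h4 : 1 - (1 / (n : ℝ)) ^ 2 / 2 ≤ Real.exp (-((1 / (n : ℝ)) ^ 2 / 2)) := by
        have := Real.add_one_le_exp (-((1 / (n : ℝ)) ^ 2 / 2))
        linarith
      have h5 : 0 ≤ 1 - (1 / (n : ℝ)) ^ 2 / 2 := by
        have h3 : (0 : ℝ) ≤ 1 / n := by positivity
        nlinarith
      refine (pow_le_pow_left₀ h5 h4 _).trans ?_
      rw [← Real.exp_nat_mul]
      apply le_of_eq
      congr 1
      push_cast; field_simp
    rw [e1]
    gcongr
  linarith

/-- The operator `A` takes its values in the range of `j`. The flow estimate for `R = A` and for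
`ξ = j (π (A p)) - A p` reads `‖π (A p)‖ + ‖ξ‖ ≤ ‖j (π (A p))‖`, which leaves no room for `ξ`. -/
theorem incl_proj_eq (h : FlowBounds π j A c) (p : Y) : j (π (A p)) = A p := by
  have h1 := h.norm_add_norm_le A (fun _ => rfl) p (j (π (A p)) - A p)
    (by rw [map_sub, h.proj_incl, sub_self])
  rw [add_sub_cancel] at h1
  have h2 := h.norm_incl_le (π (A p))
  have h3 : ‖j (π (A p)) - A p‖ ≤ 0 := by linarith
  exact sub_eq_zero.mp (norm_le_zero_iff.mp h3)

/-- The space `Z` is the `ℓ¹`-sum of `j Y` and the kernel of `π`. For `Y = X*` and `Z = X***` this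
says that `X` is an M-ideal in its bidual. -/
theorem norm_add_norm_le_incl_add (h : FlowBounds π j A c) (p : Y) (ξ : Z) (hξ : π ξ = 0) :
    ‖p‖ + ‖ξ‖ ≤ ‖j p + ξ‖ := by
  have h1 := h.norm_add_norm_le j (fun p => by rw [h.proj_incl, h.incl_proj_eq]) p ξ hξ
  rwa [h.proj_incl] at h1

/-- An operator `U` on `Z` that is skew (to first order, `1 ± t U` do not increase norms) leaves the
kernel of `π` invariant: a component of `U ξ` in `j Y` would make `‖ξ + t U ξ‖ + ‖ξ - t U ξ‖` grow
linearly in `t`, by the `ℓ¹`-decomposition. -/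
theorem proj_map_eq_zero (h : FlowBounds π j A c) (U : Z →L[𝕜] Z) (b : ℝ)
    (hU : ∀ ξ (t : ℝ), 0 ≤ t → ‖ξ + (t : 𝕜) • U ξ‖ ≤ (1 + b * t ^ 2) * ‖ξ‖)
    (hU' : ∀ ξ (t : ℝ), 0 ≤ t → ‖ξ - (t : 𝕜) • U ξ‖ ≤ (1 + b * t ^ 2) * ‖ξ‖)
    (ξ : Z) (hξ : π ξ = 0) : π (U ξ) = 0 := by
  set q := π (U ξ) with hq
  set η := U ξ - j q with hη
  have hπη : π η = 0 := by rw [hη, map_sub, h.proj_incl, ← hq, sub_self]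
  have key : ∀ t : ℝ, 0 < t → ‖q‖ ≤ b * ‖ξ‖ * t := by
    intro t ht
    have h1 := hU ξ t ht.le
    have h2 := hU' ξ t ht.le
    have e1 : ξ + (t : 𝕜) • U ξ = j ((t : 𝕜) • q) + (ξ + (t : 𝕜) • η) := by
      rw [hη, map_smul]; module
    have e2 : ξ - (t : 𝕜) • U ξ = j (-(t : 𝕜) • q) + (ξ - (t : 𝕜) • η) := by
      rw [hη, map_smul]; module
    have h3 := h.norm_add_norm_le_incl_add ((t : 𝕜) • q) (ξ + (t : 𝕜) • η)
      (by rw [map_add, map_smul, hξ, hπη, smul_zero, add_zero])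
    have h4 := h.norm_add_norm_le_incl_add (-(t : 𝕜) • q) (ξ - (t : 𝕜) • η)
      (by rw [map_sub, map_smul, hξ, hπη, smul_zero, sub_zero])
    rw [← e1, norm_smul, RCLike.norm_ofReal, abs_of_pos ht] at h3
    rw [← e2, norm_smul, norm_neg, RCLike.norm_ofReal, abs_of_pos ht] at h4
    have h5 : 2 * ‖ξ‖ ≤ ‖ξ + (t : 𝕜) • η‖ + ‖ξ - (t : 𝕜) • η‖ := by
      have := norm_add_le (ξ + (t : 𝕜) • η) (ξ - (t : 𝕜) • η)
      rwa [add_add_sub_cancel, ← two_smul 𝕜 ξ, norm_smul, RCLike.norm_ofNat] at this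
    have h6 : t * ‖q‖ ≤ t * (b * ‖ξ‖ * t) := by nlinarith
    exact le_of_mul_le_mul_left h6 ht
  have hlim : Tendsto (fun t : ℝ => b * ‖ξ‖ * t) (𝓝[>] 0) (𝓝 (b * ‖ξ‖ * 0)) :=
    (tendsto_id.const_mul _).mono_left nhdsWithin_le_nhds
  have := ge_of_tendsto hlim (eventually_mem_nhdsWithin.mono fun t ht => key t ht)
  rw [mul_zero] at this
  exact norm_le_zero_iff.mp this

end FlowBounds

end Flow

/-! ### Adjoints and the triple dual -/

section Bidual

-- needed for the instances on the triple dual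
set_option maxSynthPendingDepth 6

variable {𝕜 : Type*} [RCLike 𝕜] {E : Type*} [NormedAddCommGroup E] [NormedSpace 𝕜 E]

/-- The adjoint `T* : F* → E*`, `f ↦ f ∘ T`, of a bounded operator `T : E → F`. -/
def dualOperator {F : Type*} [NormedAddCommGroup F] [NormedSpace 𝕜 F] (T : E →L[𝕜] F) :
    StrongDual 𝕜 F →L[𝕜] StrongDual 𝕜 E :=
  ContinuousLinearMap.precomp 𝕜 T

@[simp]
theorem dualOperator_apply {F : Type*} [NormedAddCommGroup F] [NormedSpace 𝕜 F] (T : E →L[𝕜] F)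
    (f : StrongDual 𝕜 F) (x : E) : dualOperator T f x = f (T x) :=
  rfl

theorem norm_add_smul_dualOperator_le {T : E →L[𝕜] E} {a : 𝕜} {C : ℝ} (hC : 0 ≤ C)
    (h : ∀ x, ‖x + a • T x‖ ≤ C * ‖x‖) (f : StrongDual 𝕜 E) :
    ‖f + a • dualOperator T f‖ ≤ C * ‖f‖ := by
  refine ContinuousLinearMap.opNorm_le_bound _ (by positivity) fun x => ?_
  have e : (f + a • dualOperator T f) x = f (x + a • T x) := by
    simp
  rw [e]
  calc ‖f (x + a • T x)‖ ≤ ‖f‖ * (C * ‖x‖) := f.le_opNorm_of_le (h x)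
    _ = _ := by ring

theorem norm_add_smul_dualOperator_dualOperator_le {T : E →L[𝕜] E} {a : 𝕜} {C : ℝ} (hC : 0 ≤ C)
    (h : ∀ x, ‖x + a • T x‖ ≤ C * ‖x‖) (ξ : StrongDual 𝕜 (StrongDual 𝕜 E)) :
    ‖ξ + a • dualOperator (dualOperator T) ξ‖ ≤ C * ‖ξ‖ :=
  norm_add_smul_dualOperator_le hC (norm_add_smul_dualOperator_le hC h) ξ

/-- The second adjoint of the skew operator `V = π A - 1` leaves the kernel of `π` invariant. -/
theorem FlowBounds.proj_dualOperator_dualOperator_eq_zero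
    {π : StrongDual 𝕜 (StrongDual 𝕜 E) →L[𝕜] E} {j A : E →L[𝕜] StrongDual 𝕜 (StrongDual 𝕜 E)}
    {c : ℝ} (h : FlowBounds π j A c) {V : E →L[𝕜] E} (hV : ∀ q, V q = π (A q) - q)
    (ξ : StrongDual 𝕜 (StrongDual 𝕜 E)) (hξ : π ξ = 0) :
    π (dualOperator (dualOperator V) ξ) = 0 := by
  have hc := h.nonneg
  refine h.proj_map_eq_zero (dualOperator (dualOperator V)) c (fun ξ t ht => ?_)
    (fun ξ t ht => ?_) ξ hξ
  · refine norm_add_smul_dualOperator_dualOperator_le (by positivity) (fun q => ?_) ξ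
    rw [hV]
    exact h.skew q t ht
  · rw [sub_eq_add_neg, ← neg_smul]
    refine norm_add_smul_dualOperator_dualOperator_le (by positivity) (fun q => ?_) ξ
    rw [hV, neg_smul, ← sub_eq_add_neg]
    exact h.norm_sub_smul_skew_le q ht

open NormedSpace in
/-- On the dual of a Banach space `E`, with `π` the restriction of functionals from `E**` to `E`,
the skew operator `V = π A - 1` is the adjoint of an operator `W` on `E`. Indeed `V**` leaves `E^⊥`,
the kernel of `π`, invariant, so `V*` maps `E` into `E^⊥⊥ ∩ E** = E`. -/
theorem FlowBounds.exists_preadjoint [CompleteSpace E]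
    {A : StrongDual 𝕜 E →L[𝕜] StrongDual 𝕜 (StrongDual 𝕜 (StrongDual 𝕜 E))} {c : ℝ}
    (h : FlowBounds (dualOperator (inclusionInDoubleDual 𝕜 E))
      (inclusionInDoubleDual 𝕜 (StrongDual 𝕜 E)) A c) :
    ∃ W : E →L[𝕜] E, ∀ (q : StrongDual 𝕜 E) (x : E),
      A q (inclusionInDoubleDual 𝕜 E x) = q x + q (W x) := by
  set ι := inclusionInDoubleDual 𝕜 E
  set V : StrongDual 𝕜 E →L[𝕜] StrongDual 𝕜 E :=
    dualOperator ι ∘L A - ContinuousLinearMap.id 𝕜 _ with hV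
  have hVapp : ∀ q, V q = dualOperator ι (A q) - q := fun q => rfl
  have hli : Isometry ι := (inclusionInDoubleDualLi 𝕜 (E := E)).isometry
  have hclosed : IsClosed (Set.range ι) := hli.isClosedEmbedding.isClosed_range
  have hmem : ∀ x, ∃ y, ι y = dualOperator V (ι x) := by
    intro x
    by_contra hcon
    obtain ⟨ξ, h1, h2⟩ := Submodule.exists_dual_eq_zero_ne_zero_of_isClosed
      (p := ι.toLinearMap.range) (by rw [LinearMap.coe_range]; exact hclosed)
      (x := dualOperator V (ι x)) (by simpa using hcon)
    have hξ : dualOperator ι ξ = 0 := by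
      ext y
      exact h1 _ ⟨y, rfl⟩
    exact h2 (DFunLike.congr_fun (h.proj_dualOperator_dualOperator_eq_zero hVapp ξ hξ) x)
  choose W hW using hmem
  refine ⟨LinearMap.mkContinuous
    { toFun := W
      map_add' := fun x y => hli.injective (by simp only [hW, map_add])
      map_smul' := fun a x => hli.injective (by simp only [hW, map_smul, RingHom.id_apply]) }
    ‖dualOperator V‖ fun x => ?_, fun q x => ?_⟩
  · have h1 : ‖ι (W x)‖ = ‖W x‖ := (inclusionInDoubleDualLi 𝕜 (E := E)).norm_map (W x)
    have h2 : ‖ι x‖ = ‖x‖ := (inclusionInDoubleDualLi 𝕜 (E := E)).norm_map x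
    change ‖W x‖ ≤ _
    rw [← h1, hW, ← h2]
    exact (dualOperator V).le_opNorm _
  · have h1 : q (W x) = V q x := DFunLike.congr_fun (hW x) q
    change _ = q x + q (W x)
    rw [h1, hVapp]
    exact (add_sub_cancel (q x) (A q (ι x))).symm

end Bidual

/-! ### Approximation in M-ideals -/

section LProjection

variable {𝕜 : Type*} [RCLike 𝕜] {E : Type*} [NormedAddCommGroup E] [NormedSpace 𝕜 E]
  {F : Type*} [NormedAddCommGroup F] [NormedSpace 𝕜 F]
  {J : Submodule 𝕜 E} {P : StrongDual 𝕜 E →L[𝕜] StrongDual 𝕜 E}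

theorem IsLprojection.norm_eq_add (hP : IsLprojection (StrongDual 𝕜 E) P)
    (φ : StrongDual 𝕜 E) : ‖φ‖ = ‖P φ‖ + ‖φ - P φ‖ :=
  hP.Lnorm φ

theorem apply_mem_of_range_eq_dualAnnihilator (hr : P.range = dualAnnihilator J)
    (φ : StrongDual 𝕜 E) : P φ ∈ dualAnnihilator J :=
  hr ▸ ⟨φ, rfl⟩

theorem IsLprojection.apply_eq_self (hP : IsLprojection (StrongDual 𝕜 E) P)
    (hr : P.range = dualAnnihilator J) {θ : StrongDual 𝕜 E} (hθ : θ ∈ dualAnnihilator J) :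
    P θ = θ := by
  rw [← hr] at hθ
  obtain ⟨φ, rfl⟩ := hθ
  exact DFunLike.congr_fun hP.proj φ

/-- The approximation property of an M-ideal `J`: for `S ∈ J` and `T` in the unit balls there is
`K ∈ J` with `S + T - K` almost in the unit ball and `L K` close to the value `w` that `1 - P`,
acting on functionals that factor through `L`, prescribes at `T`. -/
theorem IsLprojection.exists_mem_norm_add_sub_lt (hP : IsLprojection (StrongDual 𝕜 E) P)
    (hr : P.range = dualAnnihilator J) {S T : E} (hSJ : S ∈ J) (hS : ‖S‖ ≤ 1) (hT : ‖T‖ ≤ 1)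
    (L : E →L[𝕜] F) (w : F)
    (hw : ∀ g : StrongDual 𝕜 F, g w = (g ∘L L) T - P (g ∘L L) T) {ε : ℝ} (hε : 0 < ε) :
    ∃ K ∈ J, ‖S + T - K‖ < 1 + ε ∧ ‖w - L K‖ < ε := by
  refine exists_mem_norm_sub_lt_of_dual_bound J L (S + T) w (fun φ g hφ => ?_) hε
  have h1 : P φ + P (g ∘L L) = φ + g ∘L L := by rw [← map_add, hP.apply_eq_self hr hφ]
  have h2 : P φ T + P (g ∘L L) T = φ T + (g ∘L L) T := DFunLike.congr_fun h1 T
  have h3 : P φ S = 0 := apply_mem_of_range_eq_dualAnnihilator hr φ S hSJ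
  have h4 : φ (S + T) + g w = (φ - P φ) S + P φ T := by
    rw [hw, map_add, sub_apply, h3]
    linear_combination -h2
  rw [h4]
  calc RCLike.re ((φ - P φ) S + P φ T) ≤ ‖(φ - P φ) S + P φ T‖ := RCLike.re_le_norm _
    _ ≤ ‖φ - P φ‖ * 1 + ‖P φ‖ * 1 :=
      (norm_add_le _ _).trans (add_le_add ((φ - P φ).le_opNorm_of_le hS) ((P φ).le_opNorm_of_le hT))
    _ = ‖φ‖ := by rw [hP.norm_eq_add φ]; ring

/-- The elements of an M-ideal `J` that approximate `T`, in the sense of the values of functionals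
that factor through `L`, can be taken of norm almost at most one. -/
theorem IsLprojection.exists_mem_norm_lt (hP : IsLprojection (StrongDual 𝕜 E) P)
    (hr : P.range = dualAnnihilator J) {T : E} (hT : ‖T‖ ≤ 1) (L : E →L[𝕜] F) (w : F)
    (hw : ∀ g : StrongDual 𝕜 F, g w = (g ∘L L) T - P (g ∘L L) T) {ε : ℝ} (hε : 0 < ε) :
    ∃ K ∈ J, ‖K‖ < 1 + ε ∧ ‖w - L K‖ < ε := by
  suffices h : ∀ (φ : StrongDual 𝕜 E) (g : StrongDual 𝕜 F), φ + g ∘L L ∈ dualAnnihilator J →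
      RCLike.re (φ 0 + g w) ≤ ‖φ‖ by
    obtain ⟨K, hK, h1, h2⟩ := exists_mem_norm_sub_lt_of_dual_bound J L 0 w h hε
    exact ⟨K, hK, by simpa using h1, h2⟩
  intro φ g hφ
  have h1 : P φ + P (g ∘L L) = φ + g ∘L L := by rw [← map_add, hP.apply_eq_self hr hφ]
  have h2 : P φ T + P (g ∘L L) T = φ T + (g ∘L L) T := DFunLike.congr_fun h1 T
  have h4 : φ 0 + g w = (-(φ - P φ)) T := by
    rw [hw, map_zero, neg_apply, sub_apply]
    linear_combination -h2
  rw [h4]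
  calc RCLike.re ((-(φ - P φ)) T) ≤ ‖(-(φ - P φ)) T‖ := RCLike.re_le_norm _
    _ ≤ ‖-(φ - P φ)‖ * 1 := (-(φ - P φ)).le_opNorm_of_le hT
    _ ≤ ‖φ‖ := by rw [hP.norm_eq_add φ, norm_neg]; linarith [norm_nonneg (P φ)]

/-- For scalar-valued `L = φ` the target `w = φ T - P φ T` has the property that the approximation
lemmas ask for. -/
theorem apply_sub_eq_comp_apply_sub (P : StrongDual 𝕜 E →L[𝕜] StrongDual 𝕜 E)
    (φ : StrongDual 𝕜 E) (T : E) (g : StrongDual 𝕜 𝕜) :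
    g (φ T - P φ T) = (g ∘L φ) T - P (g ∘L φ) T := by
  have hg : ∀ a, g a = g 1 * a := fun a => by
    rw [mul_comm, ← smul_eq_mul, ← map_smul, smul_eq_mul, mul_one]
  have e : g ∘L φ = g 1 • φ := by
    ext S
    exact hg _
  rw [e, map_smul, smul_apply, smul_apply, hg, smul_eq_mul, smul_eq_mul, mul_sub]

end LProjection

/-! ### Numerical range and growth of norms -/

section NumericalRange

variable {𝕜 : Type*} [RCLike 𝕜] {X : Type*} [NormedAddCommGroup X] [NormedSpace 𝕜 X]

/-- If the numerical range of `M` lies in the half-plane `re ≤ w`, then `1 + t M` is bounded by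
`1 + t w` to first order in `t`. The operator `1 - t M` is bounded below by `1 - t w`, and
`(1 - t M) (1 + t M) = 1 - t² M²`. -/
theorem mul_norm_add_smul_le_of_numericalRange_le {M : X →L[𝕜] X} {w t : ℝ} (ht : 0 ≤ t)
    (h : ∀ p ∈ numericalPairs 𝕜 X, RCLike.re (p.1 (M p.2)) ≤ w) (x : X) :
    (1 - t * w) * ‖x + (t : 𝕜) • M x‖ ≤ (1 + ‖M‖ ^ 2 * t ^ 2) * ‖x‖ := by
  have hlow : ∀ y : X, (1 - t * w) * ‖y‖ ≤ ‖y - (t : 𝕜) • M y‖ := by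
    intro y
    rcases eq_or_ne y 0 with rfl | hy
    · simp
    have hy0 : 0 < ‖y‖ := norm_pos_iff.mpr hy
    obtain ⟨f, hf, hfy⟩ := exists_dual_vector 𝕜 y hy0.ne'
    have hmem : (f, ((‖y‖⁻¹ : ℝ) : 𝕜) • y) ∈ numericalPairs 𝕜 X := by
      refine ⟨hf, ?_, ?_⟩
      · simp [norm_smul, hy0.ne']
      · simp only [map_smul, hfy, smul_eq_mul, ← RCLike.ofReal_mul]
        rw [inv_mul_cancel₀ hy0.ne', RCLike.ofReal_one]
    have h1 := h _ hmem
    simp only [map_smul, smul_eq_mul, RCLike.re_ofReal_mul] at h1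
    rw [inv_mul_le_iff₀ hy0] at h1
    have h2 : RCLike.re (f (y - (t : 𝕜) • M y)) = ‖y‖ - t * RCLike.re (f (M y)) := by
      rw [map_sub, map_smul, hfy, map_sub, smul_eq_mul, RCLike.re_ofReal_mul, RCLike.ofReal_re]
    have h3 := (RCLike.re_le_norm _).trans (f.le_opNorm (y - (t : 𝕜) • M y))
    rw [h2, hf, one_mul] at h3
    have h4 := mul_le_mul_of_nonneg_left h1 ht
    linarith
  refine (hlow _).trans ?_
  have e : x + (t : 𝕜) • M x - (t : 𝕜) • M (x + (t : 𝕜) • M x) =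
      x - ((t ^ 2 : ℝ) : 𝕜) • M (M x) := by
    rw [map_add, map_smul]; push_cast; module
  rw [e]
  refine (norm_sub_le _ _).trans ?_
  rw [norm_smul, RCLike.norm_ofReal, abs_of_nonneg (by positivity)]
  have h5 : ‖M (M x)‖ ≤ ‖M‖ * (‖M‖ * ‖x‖) := M.le_opNorm_of_le (M.le_opNorm x)
  have h6 := mul_le_mul_of_nonneg_left h5 (sq_nonneg t)
  linarith

theorem numericalRadius_le_norm (T : X →L[𝕜] X) : numericalRadius T ≤ ‖T‖ := by
  refine numericalRadius_le T (norm_nonneg T) fun p hp => ?_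
  have h1 := p.1.le_opNorm_of_le (T.le_opNorm p.2)
  rwa [hp.1, hp.2.1, one_mul, mul_one] at h1

theorem re_apply_sub_le_of_numericalRadius_le {T : X →L[𝕜] X} {r : ℝ}
    (h : numericalRadius T ≤ r) {p : StrongDual 𝕜 X × X} (hp : p ∈ numericalPairs 𝕜 X) :
    RCLike.re (p.1 ((T - ContinuousLinearMap.id 𝕜 X) p.2)) ≤ r - 1 := by
  have h1 := (RCLike.re_le_norm _).trans ((le_numericalRadius T hp).trans h)
  rw [sub_apply, map_sub, map_sub, ContinuousLinearMap.id_apply, hp.2.2, RCLike.one_re]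
  linarith

theorem isCompactOperator_smulRight (f : StrongDual 𝕜 X) (b : X) :
    IsCompactOperator (f.smulRight b) := by
  have h : IsCompactOperator (f : X → 𝕜) := isCompactOperator_of_locallyCompactSpace_dom f
  exact h.clm_comp ((1 : 𝕜 →L[𝕜] 𝕜).smulRight b)

end NumericalRange

/-! ### Elementary inequalities -/

section Auxiliary

variable {𝕜 : Type*} [RCLike 𝕜] {E : Type*} [NormedAddCommGroup E] [NormedSpace 𝕜 E]

theorem add_mul_norm_le_of_forall_norm_le_one (φ : StrongDual 𝕜 E) {a s b : ℝ} (hs : 0 ≤ s)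
    (h : ∀ x, ‖x‖ ≤ 1 → a + s * ‖φ x‖ ≤ b) : a + s * ‖φ‖ ≤ b := by
  rcases hs.eq_or_lt with rfl | hs
  · simpa using h 0 (by simp)
  have h0 := h 0 (by simp)
  rw [map_zero, norm_zero, mul_zero, add_zero] at h0
  have : ‖φ‖ ≤ (b - a) / s := by
    refine ContinuousLinearMap.opNorm_le_of_unit_norm (div_nonneg (by linarith) hs.le)
      fun x hx => ?_
    rw [le_div_iff₀ hs]
    linarith [h x hx.le]
  rw [le_div_iff₀ hs] at this
  linarith

theorem exists_norm_one_norm_add_mul_eq (a b : 𝕜) :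
    ∃ c : 𝕜, ‖c‖ = 1 ∧ ‖a + c * b‖ = ‖a‖ + ‖b‖ := by
  obtain ⟨c₁, h₁, e₁⟩ := RCLike.exists_norm_mul_eq_self a
  obtain ⟨c₂, h₂, e₂⟩ := RCLike.exists_norm_eq_mul_self b
  refine ⟨c₁ * c₂, by rw [norm_mul, h₁, h₂, one_mul], ?_⟩
  have e : a + c₁ * c₂ * b = c₁ * ((‖a‖ + ‖b‖ : ℝ) : 𝕜) := by
    rw [RCLike.ofReal_add, e₂]
    linear_combination -e₁
  rw [e, norm_mul, h₁, one_mul, RCLike.norm_ofReal, abs_of_nonneg (by positivity)]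

theorem le_of_forall_pos_mul_sub_le {t a b : ℝ}
    (h : ∀ ε : ℝ, 0 < ε → ε ≤ 1 → t * ε < 1 → (1 - t * ε) * (a - t * ε) ≤ b) : a ≤ b := by
  have hlim : Tendsto (fun ε : ℝ => (1 - t * ε) * (a - t * ε)) (𝓝[>] 0)
      (𝓝 ((1 - t * 0) * (a - t * 0))) :=
    (by fun_prop : Continuous fun ε : ℝ => (1 - t * ε) * (a - t * ε)).continuousAt.mono_left
      nhdsWithin_le_nhds
  have := le_of_tendsto hlim (b := b) (by
    have h0 : ∀ᶠ ε : ℝ in 𝓝 0, t * ε < 1 :=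
      (by fun_prop : Continuous fun ε : ℝ => t * ε).continuousAt.eventually (gt_mem_nhds (by simp))
    filter_upwards [self_mem_nhdsWithin, nhdsWithin_le_nhds (Iic_mem_nhds one_pos),
      nhdsWithin_le_nhds h0] with ε h1 h2 h3
    exact h ε h1 h2 h3)
  simpa using this

end Auxiliary

/-! ### The limit operator of the compact operators -/

section RadiusSpace

-- needed for the instances on the triple dual
set_option maxSynthPendingDepth 6

open NormedSpace NumericalRadiusSpace

variable {𝕜 : Type u} [RCLike 𝕜] {X : Type v} [NormedAddCommGroup X] [NormedSpace 𝕜 X]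
  (hn : 0 < numericalIndex 𝕜 X)

/-- The identification of `L_v(X)` with `L(X)`, as a bounded operator. -/
def radiusToCLM : NumericalRadiusSpace hn →L[𝕜] (X →L[𝕜] X) :=
  LinearMap.mkContinuous (toCLM hn).toLinearMap (numericalIndex 𝕜 X)⁻¹ fun T => by
    rw [inv_mul_eq_div, le_div_iff₀ hn, mul_comm]
    exact numericalIndex_mul_norm_le (toCLM hn T)

/-- The functional `T ↦ z (T* q)` on `L_v(X)`, for `q ∈ X*` and `z ∈ X**`, as a bounded bilinear
function of `q` and `z`. -/
def elementaryFunctional : StrongDual 𝕜 X →L[𝕜] StrongDual 𝕜 (StrongDual 𝕜 X) →L[𝕜]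
    StrongDual 𝕜 (NumericalRadiusSpace hn) :=
  (ContinuousLinearMap.compL 𝕜 (NumericalRadiusSpace hn) (StrongDual 𝕜 X) 𝕜).flip ∘L
    ContinuousLinearMap.precomp (StrongDual 𝕜 X) (radiusToCLM hn) ∘L
      ContinuousLinearMap.compL 𝕜 X X 𝕜

/-- The identity operator of `X`, as an element of `L_v(X)`. -/
def radiusOne : NumericalRadiusSpace hn := (toCLM hn).symm (ContinuousLinearMap.id 𝕜 X)

/-- The operator `A : X* → X***` with `A q z = ((1 - P) ω) (1)`, where `ω` is the functional
`T ↦ z (T* q)` on `L_v(X)` and `1` is the identity of `X`. If `P` is the projection that belongs to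
the M-ideal `K_v(X)`, then `A q` is the weak-star limit of `K_α* q`, where `K_α` is a net of compact
operators that converges weakly to the identity in `K_v(X)** ⊆ L_v(X)**`. That `A` is the canonical
embedding is the heart of the matter. -/
def limitOperator (P : StrongDual 𝕜 (NumericalRadiusSpace hn) →L[𝕜]
    StrongDual 𝕜 (NumericalRadiusSpace hn)) :
    StrongDual 𝕜 X →L[𝕜] StrongDual 𝕜 (StrongDual 𝕜 (StrongDual 𝕜 X)) :=
  ContinuousLinearMap.compL 𝕜 (StrongDual 𝕜 (StrongDual 𝕜 X))
      (StrongDual 𝕜 (NumericalRadiusSpace hn)) 𝕜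
      (inclusionInDoubleDual 𝕜 _ (radiusOne hn) ∘L (ContinuousLinearMap.id 𝕜 _ - P)) ∘L
    elementaryFunctional hn

theorem limitOperator_apply (P : StrongDual 𝕜 (NumericalRadiusSpace hn) →L[𝕜]
    StrongDual 𝕜 (NumericalRadiusSpace hn)) (q : StrongDual 𝕜 X)
    (z : StrongDual 𝕜 (StrongDual 𝕜 X)) :
    limitOperator hn P q z = z q - P (elementaryFunctional hn q z) (radiusOne hn) := rfl

theorem norm_radiusOne_le : ‖radiusOne hn‖ ≤ 1 := by
  rw [norm_def, radiusOne, LinearEquiv.apply_symm_apply]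
  exact (numericalRadius_le_norm _).trans ContinuousLinearMap.norm_id_le

theorem norm_toCLM_le {T : NumericalRadiusSpace hn} {r : ℝ} (h : ‖T‖ ≤ r) :
    ‖toCLM hn T‖ ≤ r / numericalIndex 𝕜 X := by
  rw [le_div_iff₀ hn, mul_comm]
  exact (numericalIndex_mul_norm_le (toCLM hn T)).trans h

/-- The rank-one operator `x ↦ f(x) b`, as an element of `L_v(X)`. -/
def radiusRankOne (f : StrongDual 𝕜 X) (b : X) : NumericalRadiusSpace hn :=
  (toCLM hn).symm (f.smulRight b)

theorem radiusRankOne_mem_compacts (f : StrongDual 𝕜 X) (b : X) :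
    radiusRankOne hn f b ∈ compacts hn :=
  isCompactOperator_smulRight f b

theorem norm_radiusRankOne_le (f : StrongDual 𝕜 X) (b : X) :
    ‖radiusRankOne hn f b‖ ≤ ‖f‖ * ‖b‖ := by
  rw [norm_def, radiusRankOne, LinearEquiv.apply_symm_apply]
  exact (numericalRadius_le_norm _).trans (f.norm_smulRight_apply b).le

variable {hn}

/-- An operator `T` of numerical radius at most `1 + ε` has `re p (T x - x) ≤ ε` on `Π(X)`, which
bounds `1 + t (T - 1)` to first order in `t`. -/
theorem mul_norm_add_smul_sub_le {T : NumericalRadiusSpace hn} {ε t : ℝ} (hε : ε ≤ 1)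
    (hT : ‖T‖ ≤ 1 + ε) (ht : 0 ≤ t) (x : X) :
    (1 - t * ε) * ‖x + (t : 𝕜) • (toCLM hn T x - x)‖ ≤
      (1 + (2 / numericalIndex 𝕜 X + 1) ^ 2 * t ^ 2) * ‖x‖ := by
  set M : X →L[𝕜] X := toCLM hn T - ContinuousLinearMap.id 𝕜 X with hM
  have h1 := mul_norm_add_smul_le_of_numericalRange_le (M := M) (w := ε) ht (fun p hp => by
    have := re_apply_sub_le_of_numericalRadius_le (T := toCLM hn T) hT hp
    linarith) x
  have h2 : ‖M‖ ≤ 2 / numericalIndex 𝕜 X + 1 :=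
    (norm_sub_le _ _).trans (add_le_add (norm_toCLM_le hn (by linarith))
      ContinuousLinearMap.norm_id_le)
  have h3 : M x = toCLM hn T x - x := rfl
  rw [h3] at h1
  refine h1.trans ?_
  gcongr

variable {P : StrongDual 𝕜 (NumericalRadiusSpace hn) →L[𝕜] StrongDual 𝕜 (NumericalRadiusSpace hn)}

/-- The bound `FlowBounds.skew` for the limit operator: approximate the identity by a compact `K`
with `v(K) ≤ 1 + ε` and apply the numerical range estimate to `K - 1`. -/
theorem norm_add_smul_limitOperator_sub_le
    (hP : IsLprojection (StrongDual 𝕜 (NumericalRadiusSpace hn)) P)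
    (hr : P.range = dualAnnihilator (compacts hn)) (q : StrongDual 𝕜 X) {t : ℝ} (ht : 0 ≤ t) :
    ‖q + (t : 𝕜) • (dualOperator (inclusionInDoubleDual 𝕜 X) (limitOperator hn P q) - q)‖ ≤
      (1 + (2 / numericalIndex 𝕜 X + 1) ^ 2 * t ^ 2) * ‖q‖ := by
  refine ContinuousLinearMap.opNorm_le_bound _ (by positivity) fun x => ?_
  refine le_of_forall_pos_mul_sub_le (t := t) fun ε hε hε1 hε2 => ?_
  set z := inclusionInDoubleDual 𝕜 X x with hz
  obtain ⟨K, -, hK1, hK2⟩ := hP.exists_mem_norm_lt hr (norm_radiusOne_le hn)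
    (elementaryFunctional hn q z) (limitOperator hn P q z)
    (apply_sub_eq_comp_apply_sub P (elementaryFunctional hn q z) (radiusOne hn)) hε
  have hx := mul_norm_add_smul_sub_le hε1 hK1.le ht x
  have hK3 : elementaryFunctional hn q z K = q (toCLM hn K x) := rfl
  rw [hK3] at hK2
  have e1 : (q + (t : 𝕜) • (dualOperator (inclusionInDoubleDual 𝕜 X) (limitOperator hn P q) - q)) x
      = q (x + (t : 𝕜) • (toCLM hn K x - x)) +
        (t : 𝕜) * (limitOperator hn P q z - q (toCLM hn K x)) := by
    simp only [add_apply, smul_apply, sub_apply, dualOperator_apply, map_add, map_smul, map_sub,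
      smul_eq_mul]
    ring
  rw [e1]
  have e2 : ‖(t : 𝕜) * (limitOperator hn P q z - q (toCLM hn K x))‖ ≤ t * ε := by
    rw [norm_mul, RCLike.norm_ofReal, abs_of_nonneg ht]
    gcongr
  have e3 := norm_add_le (q (x + (t : 𝕜) • (toCLM hn K x - x)))
    ((t : 𝕜) * (limitOperator hn P q z - q (toCLM hn K x)))
  have e4 := q.le_opNorm (x + (t : 𝕜) • (toCLM hn K x - x))
  have e5 : 0 ≤ 1 - t * ε := by linarith
  calc _ ≤ (1 - t * ε) * (‖q‖ * ‖x + (t : 𝕜) • (toCLM hn K x - x)‖) := by gcongr; linarith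
    _ = ‖q‖ * ((1 - t * ε) * ‖x + (t : 𝕜) • (toCLM hn K x - x)‖) := by ring
    _ ≤ ‖q‖ * ((1 + (2 / numericalIndex 𝕜 X + 1) ^ 2 * t ^ 2) * ‖x‖) := by gcongr
    _ = _ := by ring

/-- For `f` and `b` in the unit balls let `S = f ⊗ b` and approximate the identity by a compact `K`
with `v(S + 1 - K) ≤ 1 + ε`. The numerical range estimate bounds the norm of `T = 1 + t (S - K)`,
and the left side is approximately `ρ (T** z)`. -/
theorem norm_apply_sub_smul_limitOperator_add_le
    (hP : IsLprojection (StrongDual 𝕜 (NumericalRadiusSpace hn)) P)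
    (hr : P.range = dualAnnihilator (compacts hn))
    (ρ : StrongDual 𝕜 (StrongDual 𝕜 (StrongDual 𝕜 X))) {t : ℝ} (ht : 0 ≤ t)
    (z : StrongDual 𝕜 (StrongDual 𝕜 X)) {f : StrongDual 𝕜 X} (hf : ‖f‖ ≤ 1) {b : X}
    (hb : ‖b‖ ≤ 1) :
    ‖(ρ - (t : 𝕜) • limitOperator hn P (dualOperator (inclusionInDoubleDual 𝕜 X) ρ)) z +
        (t : 𝕜) * (z f * dualOperator (inclusionInDoubleDual 𝕜 X) ρ b)‖ ≤
      (1 + (2 / numericalIndex 𝕜 X + 1) ^ 2 * t ^ 2) * ‖ρ‖ * ‖z‖ := by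
  refine le_of_forall_pos_mul_sub_le (t := t) fun ε hε hε1 hε2 => ?_
  set q := dualOperator (inclusionInDoubleDual 𝕜 X) ρ with hq
  have hS : ‖radiusRankOne hn f b‖ ≤ 1 := (norm_radiusRankOne_le hn f b).trans
    (mul_le_one₀ hf (norm_nonneg _) hb)
  obtain ⟨K, hKc, hK1, hK2⟩ := hP.exists_mem_norm_add_sub_lt hr
    (radiusRankOne_mem_compacts hn f b) hS (norm_radiusOne_le hn)
    (elementaryFunctional hn q z) (limitOperator hn P q z)
    (apply_sub_eq_comp_apply_sub P (elementaryFunctional hn q z) (radiusOne hn)) hε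
  set T : X →L[𝕜] X := ContinuousLinearMap.id 𝕜 X +
    (t : 𝕜) • (f.smulRight b - toCLM hn K) with hT
  have hTx : ∀ x, (1 - t * ε) * ‖T x‖ ≤
      (1 + (2 / numericalIndex 𝕜 X + 1) ^ 2 * t ^ 2) * ‖x‖ := fun x => by
    have h := mul_norm_add_smul_sub_le hε1 hK1.le ht x
    have e : x + (t : 𝕜) • (toCLM hn (radiusRankOne hn f b + radiusOne hn - K) x - x) = T x := by
      have e' : toCLM hn (radiusRankOne hn f b + radiusOne hn - K) x =
        f.smulRight b x + x - toCLM hn K x := rfl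
      rw [e', hT]
      simp only [add_apply, smul_apply, sub_apply, ContinuousLinearMap.id_apply]
      module
    rwa [e] at h
  have h1 : 0 < 1 - t * ε := by linarith
  have hTn : (1 - t * ε) * ‖T‖ ≤ 1 + (2 / numericalIndex 𝕜 X + 1) ^ 2 * t ^ 2 := by
    rw [mul_comm, ← le_div_iff₀ h1]
    refine T.opNorm_le_bound (by positivity) fun x => ?_
    rw [div_mul_eq_mul_div, le_div_iff₀ h1, mul_comm]
    exact hTx x
  have hTz : ‖dualOperator (dualOperator T) z‖ ≤ ‖z‖ * ‖T‖ := by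
    refine (ContinuousLinearMap.opNorm_comp_le z (dualOperator T)).trans ?_
    gcongr
    refine ContinuousLinearMap.opNorm_le_bound _ (norm_nonneg _) fun f => ?_
    rw [mul_comm]
    exact ContinuousLinearMap.opNorm_comp_le f T
  -- `K**` maps the bidual into `X`, so `ρ (K** z)` only depends on `q`
  obtain ⟨y, hy⟩ := IsCompactOperator.exists_map_comp_eq (K := toCLM hn K) hKc z
  have hTz' : dualOperator (dualOperator T) z = z + (t : 𝕜) •
      (z f • inclusionInDoubleDual 𝕜 X b - inclusionInDoubleDual 𝕜 X y) := by
    ext q'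
    have e : dualOperator T q' = q' + (t : 𝕜) • (q' b • f - q' ∘L toCLM hn K) := by
      ext x
      simp only [hT, dualOperator_apply, add_apply, smul_apply, sub_apply,
        ContinuousLinearMap.id_apply, ContinuousLinearMap.smulRight_apply, map_add, map_smul,
        map_sub, ContinuousLinearMap.comp_apply, smul_eq_mul]
      ring
    simp only [dualOperator_apply, add_apply, smul_apply, sub_apply, dual_def]
    rw [e, map_add, map_smul, map_sub, map_smul, hy]
    simp only [smul_eq_mul]
    ring
  have hqy : z (q ∘L toCLM hn K) = ρ (inclusionInDoubleDual 𝕜 X y) := hy q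
  have hK3 : elementaryFunctional hn q z K = ρ (inclusionInDoubleDual 𝕜 X y) := hqy
  rw [hK3] at hK2
  have e1 : (ρ - (t : 𝕜) • limitOperator hn P q) z + (t : 𝕜) * (z f * q b) =
      ρ (dualOperator (dualOperator T) z) -
        (t : 𝕜) * (limitOperator hn P q z - ρ (inclusionInDoubleDual 𝕜 X y)) := by
    have e : q b = ρ (inclusionInDoubleDual 𝕜 X b) := rfl
    rw [hTz', e]
    simp only [sub_apply, smul_apply, map_add, map_smul, map_sub, smul_eq_mul]
    ring
  rw [e1]
  have e2 : ‖(t : 𝕜) * (limitOperator hn P q z - ρ (inclusionInDoubleDual 𝕜 X y))‖ ≤ t * ε := by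
    rw [norm_mul, RCLike.norm_ofReal, abs_of_nonneg ht]
    gcongr
  have e3 := norm_sub_le (ρ (dualOperator (dualOperator T) z))
    ((t : 𝕜) * (limitOperator hn P q z - ρ (inclusionInDoubleDual 𝕜 X y)))
  have e4 := ρ.le_opNorm_of_le hTz
  calc _ ≤ (1 - t * ε) * (‖ρ‖ * (‖z‖ * ‖T‖)) := by gcongr; linarith
    _ = ‖ρ‖ * ‖z‖ * ((1 - t * ε) * ‖T‖) := by ring
    _ ≤ ‖ρ‖ * ‖z‖ * (1 + (2 / numericalIndex 𝕜 X + 1) ^ 2 * t ^ 2) := by gcongr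
    _ = _ := by ring

/-- The bound `FlowBounds.step` for the limit operator: take the supremum over `f`, `b` and `z` in
the preceding estimate. -/
theorem norm_sub_smul_limitOperator_add_le
    (hP : IsLprojection (StrongDual 𝕜 (NumericalRadiusSpace hn)) P)
    (hr : P.range = dualAnnihilator (compacts hn))
    (ρ : StrongDual 𝕜 (StrongDual 𝕜 (StrongDual 𝕜 X))) {t : ℝ} (ht : 0 ≤ t) :
    ‖ρ - (t : 𝕜) • limitOperator hn P (dualOperator (inclusionInDoubleDual 𝕜 X) ρ)‖ +
        t * ‖dualOperator (inclusionInDoubleDual 𝕜 X) ρ‖ ≤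
      (1 + (2 / numericalIndex 𝕜 X + 1) ^ 2 * t ^ 2) * ‖ρ‖ := by
  set q := dualOperator (inclusionInDoubleDual 𝕜 X) ρ with hq
  set B := (1 + (2 / numericalIndex 𝕜 X + 1) ^ 2 * t ^ 2) * ‖ρ‖ with hB
  have key : ∀ z, ‖(ρ - (t : 𝕜) • limitOperator hn P q) z‖ + t * ‖q‖ * ‖z‖ ≤ B * ‖z‖ := by
    intro z
    refine add_mul_norm_le_of_forall_norm_le_one z (by positivity) fun f hf => ?_
    rw [mul_right_comm]
    refine add_mul_norm_le_of_forall_norm_le_one q (by positivity) fun b hb => ?_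
    -- rotate `f` so that the two summands are aligned
    obtain ⟨c, hc, hc'⟩ := exists_norm_one_norm_add_mul_eq
      ((ρ - (t : 𝕜) • limitOperator hn P q) z) ((t : 𝕜) * (z f * q b))
    have h1 := norm_apply_sub_smul_limitOperator_add_le hP hr ρ ht z (f := c • f)
      (by rw [norm_smul, hc, one_mul]; exact hf) hb
    have e : (t : 𝕜) * (z (c • f) * q b) = c * ((t : 𝕜) * (z f * q b)) := by
      rw [map_smul, smul_eq_mul]; ring
    rw [← hq, e, hc', norm_mul, norm_mul, RCLike.norm_ofReal, abs_of_nonneg ht] at h1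
    linarith
  have hB0 : t * ‖q‖ ≤ B := by
    rcases eq_or_ne q 0 with h0 | h0
    · rw [h0, norm_zero, mul_zero]; positivity
    obtain ⟨z, hz, -⟩ := exists_dual_vector 𝕜 q (norm_ne_zero_iff.mpr h0)
    have := key z
    rw [hz] at this
    linarith [norm_nonneg ((ρ - (t : 𝕜) • limitOperator hn P q) z)]
  have : ‖ρ - (t : 𝕜) • limitOperator hn P q‖ ≤ B - t * ‖q‖ :=
    ContinuousLinearMap.opNorm_le_bound _ (by linarith) fun z => by linarith [key z]
  linarith

theorem flowBounds_limitOperator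
    (hP : IsLprojection (StrongDual 𝕜 (NumericalRadiusSpace hn)) P)
    (hr : P.range = dualAnnihilator (compacts hn)) :
    FlowBounds (dualOperator (inclusionInDoubleDual 𝕜 X))
      (inclusionInDoubleDual 𝕜 (StrongDual 𝕜 X)) (limitOperator hn P)
      ((2 / numericalIndex 𝕜 X + 1) ^ 2) where
  nonneg := by positivity
  norm_proj_le ρ := ContinuousLinearMap.opNorm_le_bound _ (norm_nonneg _) fun x =>
    ρ.le_opNorm_of_le (double_dual_bound 𝕜 X x)
  proj_incl q := rfl
  norm_incl_le q := double_dual_bound 𝕜 _ q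
  step ρ t ht := norm_sub_smul_limitOperator_add_le hP hr ρ ht
  skew q t ht := norm_add_smul_limitOperator_sub_le hP hr q ht

/-- For `(x*, x) ∈ Π(X)` the functional `T ↦ x* (T x)` has norm at most one on `L_v(X)` and attains
the value one at the compact operator `x* ⊗ x`; hence its component in the annihilator of the
compact operators vanishes. -/
theorem elementaryFunctional_inclusion_proj_eq_zero
    (hP : IsLprojection (StrongDual 𝕜 (NumericalRadiusSpace hn)) P)
    (hr : P.range = dualAnnihilator (compacts hn)) {p : StrongDual 𝕜 X × X}
    (hp : p ∈ numericalPairs 𝕜 X) :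
    P (elementaryFunctional hn p.1 (inclusionInDoubleDual 𝕜 X p.2)) = 0 := by
  set ω := elementaryFunctional hn p.1 (inclusionInDoubleDual 𝕜 X p.2) with hω
  have h1 : ‖ω‖ ≤ 1 := ContinuousLinearMap.opNorm_le_bound _ zero_le_one fun T => by
    rw [one_mul]
    exact le_numericalRadius (toCLM hn T) hp
  have hS : ‖radiusRankOne hn p.1 p.2‖ ≤ 1 := (norm_radiusRankOne_le hn p.1 p.2).trans
    (by rw [hp.1, hp.2.1, one_mul])
  have h2 : P ω (radiusRankOne hn p.1 p.2) = 0 :=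
    apply_mem_of_range_eq_dualAnnihilator hr ω _ (radiusRankOne_mem_compacts hn _ _)
  have h3 : ω (radiusRankOne hn p.1 p.2) = 1 := by
    have : ω (radiusRankOne hn p.1 p.2) = p.1 (p.1 p.2 • p.2) := rfl
    rw [this, hp.2.2, one_smul, hp.2.2]
  have h4 := (ω - P ω).le_opNorm_of_le hS
  rw [sub_apply, h2, h3, sub_zero, norm_one, mul_one] at h4
  have h5 := hP.norm_eq_add ω
  exact norm_le_zero_iff.mp (by linarith)

/-- The limit operator is the canonical embedding of `X*` into `X***`. Its deviation from it comes
from an operator `W` on `X` whose numerical range is `0`, and `n(X) > 0` forces `W = 0`. -/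
theorem limitOperator_eq_inclusion [CompleteSpace X]
    (hP : IsLprojection (StrongDual 𝕜 (NumericalRadiusSpace hn)) P)
    (hr : P.range = dualAnnihilator (compacts hn)) (q : StrongDual 𝕜 X) :
    limitOperator hn P q = inclusionInDoubleDual 𝕜 (StrongDual 𝕜 X) q := by
  have hflow := flowBounds_limitOperator hP hr
  obtain ⟨W, hW⟩ := hflow.exists_preadjoint
  have hW0 : W = 0 := by
    have hv : numericalRadius W ≤ 0 := numericalRadius_le W le_rfl fun p hp => by
      have h1 := hW p.1 p.2
      rw [limitOperator_apply, elementaryFunctional_inclusion_proj_eq_zero hP hr hp, zero_apply,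
        sub_zero, dual_def] at h1
      rw [left_eq_add.mp h1, norm_zero]
    have h2 := (numericalIndex_mul_norm_le W).trans hv
    have h3 := norm_nonneg W
    exact norm_le_zero_iff.mp (by nlinarith)
  have h1 : dualOperator (inclusionInDoubleDual 𝕜 X) (limitOperator hn P q) = q := by
    ext x
    have := hW q x
    rwa [hW0, zero_apply, map_zero, add_zero] at this
  have h2 := hflow.incl_proj_eq q
  rw [h1] at h2
  exact h2.symm

end RadiusSpace

/-! ### Compact approximation of the identity -/

section CompactApproximation

open NormedSpace NumericalRadiusSpace

variable {𝕜 : Type u} [RCLike 𝕜] {X : Type v} [NormedAddCommGroup X] [NormedSpace 𝕜 X]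
  [CompleteSpace X] {hn : 0 < numericalIndex 𝕜 X}

/-- There are compact operators `K` with `S + 1 - K` of norm at most `(1 + ε) / n(X)` that almost
fix a given vector. -/
theorem exists_compact_norm_sub_apply_lt (hM : IsMIdeal (compacts hn)) {S : X →L[𝕜] X}
    (hSc : IsCompactOperator S) (hS : ‖S‖ ≤ 1) (y : X) {ε : ℝ} (hε : 0 < ε) :
    ∃ K : X →L[𝕜] X, IsCompactOperator K ∧
      numericalIndex 𝕜 X * ‖S + ContinuousLinearMap.id 𝕜 X - K‖ ≤ 1 + ε ∧ ‖y - K y‖ < ε := by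
  obtain ⟨-, P, hP, hr⟩ := hM
  obtain ⟨K, hK, h1, h2⟩ := hP.exists_mem_norm_add_sub_lt hr (S := (toCLM hn).symm S)
    hSc ((numericalRadius_le_norm S).trans hS) (norm_radiusOne_le hn)
    (ContinuousLinearMap.apply 𝕜 X y ∘L radiusToCLM hn) y (fun g => by
      have h := DFunLike.congr_fun (limitOperator_eq_inclusion hP hr g)
        (inclusionInDoubleDual 𝕜 X y)
      exact h.symm) hε
  exact ⟨toCLM hn K, hK, (numericalIndex_mul_norm_le _).trans h1.le, h2⟩

/-- There are compact operators `K` with `S + 1 - K` of norm at most `(1 + ε) / n(X)` whose adjoint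
almost fixes a given functional. -/
theorem exists_compact_norm_sub_comp_lt (hM : IsMIdeal (compacts hn)) {S : X →L[𝕜] X}
    (hSc : IsCompactOperator S) (hS : ‖S‖ ≤ 1) (y : StrongDual 𝕜 X) {ε : ℝ} (hε : 0 < ε) :
    ∃ K : X →L[𝕜] X, IsCompactOperator K ∧
      numericalIndex 𝕜 X * ‖S + ContinuousLinearMap.id 𝕜 X - K‖ ≤ 1 + ε ∧ ‖y - y ∘L K‖ < ε := by
  obtain ⟨-, P, hP, hr⟩ := hM
  obtain ⟨K, hK, h1, h2⟩ := hP.exists_mem_norm_add_sub_lt hr (S := (toCLM hn).symm S)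
    hSc ((numericalRadius_le_norm S).trans hS) (norm_radiusOne_le hn)
    (ContinuousLinearMap.compL 𝕜 X X 𝕜 y ∘L radiusToCLM hn) y (fun g =>
      (DFunLike.congr_fun (limitOperator_eq_inclusion hP hr y) g).symm) hε
  exact ⟨toCLM hn K, hK, (numericalIndex_mul_norm_le _).trans h1.le, h2⟩

end CompactApproximation

/-! ### Compact operators on null nets -/

section Nets

variable {𝕜 : Type u} [RCLike 𝕜] {X : Type v} [NormedAddCommGroup X] [NormedSpace 𝕜 X]
  {ι : Type w} [Preorder ι]

theorem IsBoundedWeaklyNull.tendsto_apply {z : ι → X} (hz : IsBoundedWeaklyNull 𝕜 z)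
    (q : StrongDual 𝕜 X) : Tendsto (fun β => q (z β)) atTop (𝓝 0) := by
  have h : Continuous fun x : WeakSpace 𝕜 X => q ((toWeakSpace 𝕜 X).symm x) :=
    WeakBilin.eval_continuous (topDualPairing 𝕜 X).flip q
  have h0 : q ((toWeakSpace 𝕜 X).symm 0) = 0 := by simp
  have := (h.tendsto 0).comp hz.2
  rw [h0] at this
  exact this

/-- Compact operators map bounded weakly-null nets to norm-null nets. -/
theorem IsBoundedWeaklyNull.tendsto_compact {z : ι → X} (hz : IsBoundedWeaklyNull 𝕜 z)
    {K : X →L[𝕜] X} (hK : IsCompactOperator K) : Tendsto (fun β => K (z β)) atTop (𝓝 0) := by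
  obtain ⟨C, hC⟩ := hz.1
  refine (hK.isCompact_closure_image_closedBall C).tendsto_nhds_of_unique_mapClusterPt
    (Eventually.of_forall fun β => subset_closure ⟨z β, by simpa using hC β, rfl⟩) ?_
  intro y _ hy
  refine SeparatingDual.eq_zero_of_forall_dual_eq_zero (R := 𝕜) fun q => ?_
  have h1 : MapClusterPt (q y) atTop (fun β => q (K (z β))) :=
    hy.continuousAt_comp q.continuous.continuousAt
  have h2 : Tendsto (fun β => q (K (z β))) atTop (𝓝 0) := hz.tendsto_apply (q ∘L K)
  exact eq_of_nhds_neBot (ClusterPt.mono h1 h2)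

theorem IsBoundedWeakStarNull.tendsto_apply {z : ι → StrongDual 𝕜 X}
    (hz : IsBoundedWeakStarNull z) (x : X) : Tendsto (fun β => z β x) atTop (𝓝 0) := by
  have h : Continuous fun f : WeakDual 𝕜 X => f x := WeakDual.eval_continuous x
  exact (h.tendsto 0).comp hz.2

/-- Adjoints of compact operators map bounded weak*-null nets to norm-null nets. -/
theorem IsBoundedWeakStarNull.tendsto_compact {z : ι → StrongDual 𝕜 X}
    (hz : IsBoundedWeakStarNull z) {K : X →L[𝕜] X} (hK : IsCompactOperator K) :
    Tendsto (fun β => z β ∘L K) atTop (𝓝 0) := by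
  obtain ⟨C, hC⟩ := hz.1
  rw [Metric.tendsto_nhds]
  intro ε hε
  have hδ : 0 < ε / (2 * (|C| + 1)) := by positivity
  obtain ⟨s, -, hs, hcov⟩ := (hK.isCompact_closure_image_closedBall 1).finite_cover_balls hδ
  have hev : ∀ᶠ β in atTop, ∀ y ∈ s, ‖z β y‖ < ε / 4 := by
    rw [hs.eventually_all]
    intro y _
    have := (hz.tendsto_apply y).norm
    rw [norm_zero] at this
    exact this.eventually (gt_mem_nhds (by positivity))
  filter_upwards [hev] with β hβ
  rw [dist_zero_right]
  refine lt_of_le_of_lt (ContinuousLinearMap.opNorm_le_of_unit_norm (C := 3 * ε / 4)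
    (by positivity) fun x hx => ?_) (by linarith)
  obtain ⟨y, hy, hxy⟩ := Set.mem_iUnion₂.mp
    (hcov (subset_closure ⟨x, by simp [hx], rfl⟩))
  rw [mem_ball_iff_norm] at hxy
  have e : (z β ∘L K) x = z β (K x - y) + z β y := by
    rw [map_sub, sub_add_cancel]; rfl
  have h1 : ‖z β (K x - y)‖ ≤ (|C| + 1) * (ε / (2 * (|C| + 1))) :=
    (z β).le_of_opNorm_le_of_le ((hC β).trans (by linarith [le_abs_self C])) hxy.le
  have h2 : (|C| + 1) * (ε / (2 * (|C| + 1))) = ε / 2 := by field_simp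
  rw [e]
  refine (norm_add_le _ _).trans ?_
  linarith [hβ y hy]

end Nets

/-! ### The inequality along nets -/

section PropertyM

variable {𝕜 : Type u} [RCLike 𝕜] {X : Type v} [NormedAddCommGroup X] [NormedSpace 𝕜 X]

theorem numericalIndex_le_one [Nontrivial X] : numericalIndex 𝕜 X ≤ 1 := by
  have h := (numericalIndex_mul_norm_le (ContinuousLinearMap.id 𝕜 X)).trans
    (numericalRadius_le_norm _)
  rwa [ContinuousLinearMap.norm_id, mul_one] at h

theorem exists_compact_apply_eq {x y : X} (h : ‖x‖ ≤ ‖y‖) (hy : y ≠ 0) :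
    ∃ S : X →L[𝕜] X, IsCompactOperator S ∧ ‖S‖ ≤ 1 ∧ S y = x := by
  have hy0 : 0 < ‖y‖ := norm_pos_iff.mpr hy
  obtain ⟨f, hf, hfy⟩ := exists_dual_vector 𝕜 y hy0.ne'
  refine ⟨f.smulRight (((‖y‖⁻¹ : ℝ) : 𝕜) • x), isCompactOperator_smulRight f _, ?_, ?_⟩
  · rw [ContinuousLinearMap.norm_smulRight_apply, hf, one_mul, norm_smul, RCLike.norm_ofReal,
      abs_of_pos (by positivity), inv_mul_le_iff₀ hy0, mul_one]
    exact h
  · rw [ContinuousLinearMap.smulRight_apply, hfy, smul_smul, ← RCLike.ofReal_mul,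
      mul_inv_cancel₀ hy0.ne', RCLike.ofReal_one, one_smul]

theorem exists_compact_norm_comp_sub_le {x y : StrongDual 𝕜 X} (h : ‖x‖ ≤ ‖y‖) (hy : y ≠ 0)
    {ε : ℝ} (hε : 0 < ε) :
    ∃ S : X →L[𝕜] X, IsCompactOperator S ∧ ‖S‖ ≤ 1 ∧ ‖y ∘L S - x‖ ≤ ε := by
  have hy0 : 0 < ‖y‖ := norm_pos_iff.mpr hy
  obtain ⟨u, hu, huy⟩ := y.exists_lt_apply_of_lt_opNorm (sub_lt_self ‖y‖ hε)
  obtain ⟨c, hc, hcu⟩ := RCLike.exists_norm_eq_mul_self (y u)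
  have hu1 : ‖y u‖ ≤ ‖y‖ := y.unit_le_opNorm u hu.le
  refine ⟨x.smulRight (((‖y‖⁻¹ : ℝ) : 𝕜) • c • u), isCompactOperator_smulRight x _, ?_, ?_⟩
  · rw [ContinuousLinearMap.norm_smulRight_apply, norm_smul, norm_smul, hc, one_mul,
      RCLike.norm_ofReal, abs_of_pos (by positivity), ← mul_assoc, mul_comm ‖x‖]
    refine mul_le_one₀ ?_ (norm_nonneg _) hu.le
    rwa [inv_mul_le_iff₀ hy0, mul_one]
  · have e : y ∘L x.smulRight (((‖y‖⁻¹ : ℝ) : 𝕜) • c • u) - x =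
        ((‖y‖⁻¹ * ‖y u‖ - 1 : ℝ) : 𝕜) • x := by
      ext v
      simp only [sub_apply, smul_apply, ContinuousLinearMap.comp_apply,
        ContinuousLinearMap.smulRight_apply, map_smul, smul_eq_mul, ← hcu]
      push_cast
      ring
    have h1 : ‖y‖⁻¹ * ‖y u‖ ≤ 1 := by rwa [inv_mul_le_iff₀ hy0, mul_one]
    rw [e, norm_smul, RCLike.norm_ofReal, abs_of_nonpos (by linarith)]
    calc -(‖y‖⁻¹ * ‖y u‖ - 1) * ‖x‖ ≤ -(‖y‖⁻¹ * ‖y u‖ - 1) * ‖y‖ := by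
          gcongr
          linarith
      _ = ‖y‖ - ‖y u‖ := by field_simp; ring
      _ ≤ ε := by linarith

/-- Take `S` of rank one with `S y = x` and a compact `K` with `K y` close to `y` and `S + 1 - K` of
norm almost at most `1 / n(X)`. Since `S` and `K` map the net to norm-null nets, `S + 1 - K` maps
`y + z β` approximately to `x + z β`. -/
theorem eventually_mul_norm_add_le [CompleteSpace X] {hn : 0 < numericalIndex 𝕜 X}
    (hM : IsMIdeal (NumericalRadiusSpace.compacts hn)) (hn1 : numericalIndex 𝕜 X ≤ 1)
    {x y : X} (hxy : ‖x‖ ≤ ‖y‖) {ι : Type w} [Preorder ι] {z : ι → X}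
    (hz : IsBoundedWeaklyNull 𝕜 z) {δ : ℝ} (hδ : 0 < δ) :
    ∀ᶠ β in atTop, numericalIndex 𝕜 X * ‖x + z β‖ ≤ ‖y + z β‖ + δ := by
  set n := numericalIndex 𝕜 X
  rcases eq_or_ne y 0 with rfl | hy
  · obtain rfl : x = 0 := by simpa using hxy
    refine Eventually.of_forall fun β => ?_
    nlinarith [norm_nonneg (0 + z β)]
  obtain ⟨C, hC⟩ := hz.1
  obtain ⟨S, hSc, hS, hSy⟩ := exists_compact_apply_eq (𝕜 := 𝕜) hxy hy
  set ε := δ / (‖y‖ + |C| + 3) with hε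
  have hε0 : 0 < ε := by positivity
  have hεδ : ε * (‖y‖ + |C| + 3) = δ := by rw [hε]; field_simp
  obtain ⟨K, hKc, hK1, hK2⟩ := exists_compact_norm_sub_apply_lt hM hSc hS y hε0
  have h1 := (hz.tendsto_compact hSc).norm
  have h2 := (hz.tendsto_compact hKc).norm
  rw [norm_zero] at h1 h2
  filter_upwards [h1.eventually (gt_mem_nhds hε0), h2.eventually (gt_mem_nhds hε0)] with β h1 h2
  set T : X →L[𝕜] X := S + ContinuousLinearMap.id 𝕜 X - K with hT
  have e : x + z β = T (y + z β) - ((y - K y) + (S (z β) - K (z β))) := by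
    simp only [hT, sub_apply, add_apply, ContinuousLinearMap.id_apply, map_add, hSy]
    abel
  have h3 : ‖(y - K y) + (S (z β) - K (z β))‖ ≤ 3 * ε :=
    (norm_add_le _ _).trans (by linarith [norm_sub_le (S (z β)) (K (z β))])
  have h4 : ‖x + z β‖ ≤ ‖T‖ * ‖y + z β‖ + 3 * ε := by
    rw [e]
    exact (norm_sub_le _ _).trans (add_le_add (T.le_opNorm _) h3)
  have h5 : ‖y + z β‖ ≤ ‖y‖ + |C| := (norm_add_le _ _).trans (by
    gcongr; exact (hC β).trans (le_abs_self C))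
  calc n * ‖x + z β‖ ≤ n * (‖T‖ * ‖y + z β‖ + 3 * ε) := by gcongr
    _ = n * ‖T‖ * ‖y + z β‖ + n * (3 * ε) := by ring
    _ ≤ (1 + ε) * ‖y + z β‖ + 1 * (3 * ε) := by gcongr
    _ = ‖y + z β‖ + (ε * ‖y + z β‖ + 3 * ε) := by ring
    _ ≤ ‖y + z β‖ + (ε * (‖y‖ + |C|) + 3 * ε) := by gcongr
    _ = ‖y + z β‖ + δ := by rw [← hεδ]; ring

/-- The dual version: `(S + 1 - K)*` maps `y + z β` approximately to `x + z β`. -/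
theorem eventually_mul_norm_add_le_dual [CompleteSpace X] {hn : 0 < numericalIndex 𝕜 X}
    (hM : IsMIdeal (NumericalRadiusSpace.compacts hn)) (hn1 : numericalIndex 𝕜 X ≤ 1)
    {x y : StrongDual 𝕜 X} (hxy : ‖x‖ ≤ ‖y‖) {ι : Type w} [Preorder ι] {z : ι → StrongDual 𝕜 X}
    (hz : IsBoundedWeakStarNull z) {δ : ℝ} (hδ : 0 < δ) :
    ∀ᶠ β in atTop, numericalIndex 𝕜 X * ‖x + z β‖ ≤ ‖y + z β‖ + δ := by
  set n := numericalIndex 𝕜 X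
  rcases eq_or_ne y 0 with rfl | hy
  · obtain rfl : x = 0 := by simpa using hxy
    refine Eventually.of_forall fun β => ?_
    nlinarith [norm_nonneg (0 + z β)]
  obtain ⟨C, hC⟩ := hz.1
  set ε := δ / (‖y‖ + |C| + 4) with hε
  have hε0 : 0 < ε := by positivity
  have hεδ : ε * (‖y‖ + |C| + 4) = δ := by rw [hε]; field_simp
  obtain ⟨S, hSc, hS, hSy⟩ := exists_compact_norm_comp_sub_le hxy hy hε0
  obtain ⟨K, hKc, hK1, hK2⟩ := exists_compact_norm_sub_comp_lt hM hSc hS y hε0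
  have h1 := (hz.tendsto_compact hSc).norm
  have h2 := (hz.tendsto_compact hKc).norm
  rw [norm_zero] at h1 h2
  filter_upwards [h1.eventually (gt_mem_nhds hε0), h2.eventually (gt_mem_nhds hε0)] with β h1 h2
  set T : X →L[𝕜] X := S + ContinuousLinearMap.id 𝕜 X - K with hT
  have e : x + z β = (y + z β) ∘L T - ((y ∘L S - x) + (y - y ∘L K) + (z β ∘L S - z β ∘L K)) := by
    ext u
    simp only [hT, sub_apply, add_apply, ContinuousLinearMap.id_apply, map_add, map_sub,
      ContinuousLinearMap.comp_apply]
    ring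
  have h3 : ‖(y ∘L S - x) + (y - y ∘L K) + (z β ∘L S - z β ∘L K)‖ ≤ 4 * ε :=
    (norm_add₃_le).trans (by linarith [norm_sub_le (z β ∘L S) (z β ∘L K)])
  have h4 : ‖x + z β‖ ≤ ‖T‖ * ‖y + z β‖ + 4 * ε := by
    rw [e, mul_comm]
    exact (norm_sub_le _ _).trans (add_le_add (ContinuousLinearMap.opNorm_comp_le _ _) h3)
  have h5 : ‖y + z β‖ ≤ ‖y‖ + |C| := (norm_add_le _ _).trans (by
    gcongr; exact (hC β).trans (le_abs_self C))
  calc n * ‖x + z β‖ ≤ n * (‖T‖ * ‖y + z β‖ + 4 * ε) := by gcongr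
    _ = n * ‖T‖ * ‖y + z β‖ + n * (4 * ε) := by ring
    _ ≤ (1 + ε) * ‖y + z β‖ + 1 * (4 * ε) := by gcongr
    _ = ‖y + z β‖ + (ε * ‖y + z β‖ + 4 * ε) := by ring
    _ ≤ ‖y + z β‖ + (ε * (‖y‖ + |C|) + 4 * ε) := by gcongr
    _ = ‖y + z β‖ + δ := by rw [← hεδ]; ring

end PropertyM

/-! ### Passage to upper limits -/

theorem mul_limsup_le_limsup_of_eventually_le_add {ι : Type w} {l : Filter ι} [l.NeBot]
    {f g : ι → ℝ} {n : ℝ} (hn : 0 < n) (hf : ∀ β, 0 ≤ f β) (hg : BddAbove (Set.range g))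
    (h : ∀ δ > 0, ∀ᶠ β in l, n * f β ≤ g β + δ) : n * limsup f l ≤ limsup g l := by
  refine le_of_forall_pos_le_add fun δ hδ => ?_
  have hgb : IsBoundedUnder (· ≤ ·) l g := hg.isBoundedUnder_of_range
  have hfc : IsCoboundedUnder (· ≤ ·) l f :=
    (isBoundedUnder_of ⟨0, hf⟩ : IsBoundedUnder (· ≥ ·) l f).isCoboundedUnder_le
  have hev : ∀ᶠ β in l, f β ≤ (limsup g l + δ) / n := by
    filter_upwards [h (δ / 2) (by positivity),
      eventually_lt_of_limsup_lt (show limsup g l < limsup g l + δ / 2 by linarith) hgb]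
      with β h1 h2
    rw [le_div_iff₀ hn, mul_comm]
    linarith
  have := limsup_le_of_le hfc hev
  rwa [le_div_iff₀ hn, mul_comm] at this

theorem norm_ofReal_smul_add_smul {𝕜 : Type u} [RCLike 𝕜] {E : Type v} [NormedAddCommGroup E]
    [NormedSpace 𝕜 E] {n : ℝ} (hn : 0 ≤ n) (x z : E) :
    ‖(n : 𝕜) • x + (n : 𝕜) • z‖ = n * ‖x + z‖ := by
  rw [← smul_add, norm_smul, RCLike.norm_ofReal, abs_of_nonneg hn]

theorem bddAbove_range_norm_add {E : Type v} [NormedAddCommGroup E] {ι : Type w} {z : ι → E}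
    (hz : ∃ C : ℝ, ∀ β, ‖z β‖ ≤ C) (y : E) : BddAbove (Set.range fun β => ‖y + z β‖) := by
  obtain ⟨C, hC⟩ := hz
  refine ⟨‖y‖ + C, ?_⟩
  rintro _ ⟨β, rfl⟩
  exact (norm_add_le _ _).trans (by gcongr; exact hC β)

theorem mainTheorem6 {𝕜 : Type u} [RCLike 𝕜] {X : Type v} [NormedAddCommGroup X]
    [NormedSpace 𝕜 X] [CompleteSpace X] (hdim : ¬ FiniteDimensional 𝕜 X)
    (hn : 0 < numericalIndex 𝕜 X)
    (hM : IsMIdeal (NumericalRadiusSpace.compacts hn)) :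
    (∀ x y : X, ‖x‖ ≤ ‖y‖ →
      ∀ (ι : Type w) [Preorder ι] [IsDirectedOrder ι] [Nonempty ι] (z : ι → X),
        IsBoundedWeaklyNull 𝕜 z →
          numericalIndex 𝕜 X * limsup (fun β => ‖x + z β‖) atTop ≤
            limsup (fun β => ‖y + z β‖) atTop) ∧
    (∀ x y : StrongDual 𝕜 X, ‖x‖ ≤ ‖y‖ →
      ∀ (ι : Type w) [Preorder ι] [IsDirectedOrder ι] [Nonempty ι] (z : ι → StrongDual 𝕜 X),
        IsBoundedWeakStarNull z →
          numericalIndex 𝕜 X * limsup (fun β => ‖x + z β‖) atTop ≤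
            limsup (fun β => ‖y + z β‖) atTop) ∧
    HasPropertyM.{u, v, w} 𝕜 X (numericalIndex 𝕜 X) (numericalIndex 𝕜 X) ∧
    HasPropertyMStar.{u, v, w} 𝕜 X (numericalIndex 𝕜 X) (numericalIndex 𝕜 X) := by
  have : Nontrivial X := by
    by_contra h
    rw [not_nontrivial_iff_subsingleton] at h
    exact hdim inferInstance
  have hn1 : numericalIndex 𝕜 X ≤ 1 := numericalIndex_le_one
  have key (x y : X) (hxy : ‖x‖ ≤ ‖y‖) (ι : Type w) [Preorder ι] (z : ι → X)
      (hz : IsBoundedWeaklyNull 𝕜 z) (δ : ℝ) (hδ : δ > 0) :=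
    eventually_mul_norm_add_le hM hn1 hxy hz hδ
  have keyStar (x y : StrongDual 𝕜 X) (hxy : ‖x‖ ≤ ‖y‖) (ι : Type w) [Preorder ι]
      (z : ι → StrongDual 𝕜 X) (hz : IsBoundedWeakStarNull z) (δ : ℝ) (hδ : δ > 0) :=
    eventually_mul_norm_add_le_dual hM hn1 hxy hz hδ
  refine ⟨fun x y hxy ι _ _ _ z hz => ?_, fun x y hxy ι _ _ _ z hz => ?_,
    ⟨⟨hn, hn1⟩, ⟨hn, hn1⟩, fun x y hxy ι _ _ _ z hz => ?_⟩,
    ⟨⟨hn, hn1⟩, ⟨hn, hn1⟩, fun x y hxy ι _ _ _ z hz => ?_⟩⟩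
  · exact mul_limsup_le_limsup_of_eventually_le_add hn (fun β => norm_nonneg _)
      (bddAbove_range_norm_add hz.1 y) (key x y hxy ι z hz)
  · exact mul_limsup_le_limsup_of_eventually_le_add hn (fun β => norm_nonneg _)
      (bddAbove_range_norm_add hz.1 y) (keyStar x y hxy ι z hz)
  · refine (congrArg (limsup · atTop)
      (funext fun β => norm_ofReal_smul_add_smul hn.le x (z β))).trans_le ?_
    simpa using mul_limsup_le_limsup_of_eventually_le_add one_pos
      (fun β => mul_nonneg hn.le (norm_nonneg (x + z β))) (bddAbove_range_norm_add hz.1 y)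
      (by simpa using key x y hxy ι z hz)
  · refine (congrArg (limsup · atTop)
      (funext fun β => norm_ofReal_smul_add_smul hn.le x (z β))).trans_le ?_
    simpa using mul_limsup_le_limsup_of_eventually_le_add one_pos
      (fun β => mul_nonneg hn.le (norm_nonneg (x + z β))) (bddAbove_range_norm_add hz.1 y)
      (by simpa using keyStar x y hxy ι z hz)

end
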